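/- Let $G$ be a finite connected simple graph. A set $D\subseteq V(G)$ is a \emph{connected dominating set} if every vertex of $G$ lies in $D$ or has a neighbour in $D$, and the subgraph induced by $D$ is connected; $\gamma_c(G)$ is the minimum cardinality of such a set. Colour the vertices of $D$ black and all other vertices white; the colour-change rule says that a black vertex with exactly one white neighbour turns that neighbour black. $D$ is a \emph{zero forcing set} if repeated application of the rule turns all vertices black. $D$ is a \emph{connected dom-forcing set} if it is both a connected dominating set and a zero forcing set; $F_{cd}(G)$ is the minimum cardinality of such a set. Let $G_{p,q}$ be the $p\times q$ grid graph, i.e. the Cartesian product of the paths on $p$ and $q$ vertices. Theorem. Let $p\ge 4$ and $q\ge 4$ be integers. Then $$\gamma_c(G_{p,q})\le F_{cd}(G_{p,q})\le \gamma_c(G_{p,q})+1 .$$ If moreover neither $p$ nor $q$ is divisible by $3$, then $F_{cd}(G_{p,q})=\gamma_c(G_{p,q})$, and explicitly: (i) if $p\equiv q\equiv 1 \pmod 3$, then $F_{cd}(G_{p,q})=\dfrac{pq+p+q-3}{3}$; (ii) if neither $p$ nor $q$ is divisible by $3$ and $p\equiv 2\pmod 3$ or $q\equiv 2 \pmod 3$,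 then $F_{cd}(G_{p,q})=\dfrac{pq+p+q-2}{3}$. -/

import Mathlib

namespace DomForcing

/-- `D` is a dominating set: every vertex is in `D` or has a neighbour in `D`. -/
def IsDominating {V : Type*} (G : SimpleGraph V) (D : Finset V) : Prop :=
  ∀ v : V, v ∈ D ∨ ∃ u ∈ D, G.Adj u v

/-- The vertices that become black when exactly the vertices of `Z` are black at the start and the
color-change rule is applied repeatedly: a black vertex `u`, all of whose neighbours other than `v`
are black, forces its neighbour `v` to become black. -/
inductive Black {V : Type*} (G : SimpleGraph V) (Z : Finset V) : V → Prop
  | initial {v : V} (hv : v ∈ Z) : Black G Z v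
  | force {u v : V} (hu : Black G Z u) (huv : G.Adj u v)
      (hother : ∀ w : V, G.Adj u w → w ≠ v → Black G Z w) : Black G Z v

/-- `Z` is a zero forcing set: the color-change rule eventually turns every vertex black. -/
def IsZeroForcing {V : Type*} (G : SimpleGraph V) (Z : Finset V) : Prop :=
  ∀ v : V, Black G Z v

/-- A dominating set whose induced subgraph is connected. -/
def IsConnectedDominating {V : Type*} (G : SimpleGraph V) (D : Finset V) : Prop :=
  IsDominating G D ∧ (G.induce (D : Set V)).Connected

/-- A zero forcing set whose induced subgraph is connected. -/
def IsConnectedZeroForcing {V : Type*} (G : SimpleGraph V) (Z : Finset V) : Prop :=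
  IsZeroForcing G Z ∧ (G.induce (Z : Set V)).Connected

/-- A connected dom-forcing set: both a connected dominating set and a connected zero forcing
set. -/
def IsConnectedDomForcing {V : Type*} (G : SimpleGraph V) (D : Finset V) : Prop :=
  IsConnectedDominating G D ∧ IsConnectedZeroForcing G D

/-- The connected domination number `γ_c(G)`: the least cardinality of a connected dominating set
(the minimum is attained for every finite connected graph). -/
noncomputable def connectedDominationNumber {V : Type*} (G : SimpleGraph V) : ℕ :=
  sInf {n : ℕ | ∃ D : Finset V, IsConnectedDominating G D ∧ D.card = n}

/-- The connected dom-forcing number `F_cd(G)`: the least cardinality of a connected dom-forcing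
set (the minimum is attained for every finite connected graph). -/
noncomputable def connectedDomForcingNumber {V : Type*} (G : SimpleGraph V) : ℕ :=
  sInf {n : ℕ | ∃ D : Finset V, IsConnectedDomForcing G D ∧ D.card = n}

/-- The `p × q` grid graph: the Cartesian product of the paths on `p` and on `q` vertices. -/
def grid (p q : ℕ) : SimpleGraph (Fin p × Fin q) :=
  SimpleGraph.boxProd (SimpleGraph.pathGraph p) (SimpleGraph.pathGraph q)

end DomForcing

/-!
The upper bound comes from an explicit set, the comb: a spine in the second row, teeth in every
third column, one extra cell below the end of the spine, and some pegs if the last column is not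
dominated by the teeth. The extra cell lets the end of the spine force the corner; then the whole
first row is forced, and the remaining rows follow one by one (`comb_zeroForcing`). Its size, or
that of the transposed comb, is at most one above the lower bounds below, and meets them if `3`
divides neither side.

The lower bound concerns an arbitrary connected dominating set `S` of the `p × q` grid. The
`(p + 1) * (q + 1)` windows, that is the `2 × 2` blocks of cells that meet the grid, get an excess:
`-2` if the window contains no cell of `S`, `4` if it is contained in `S` or contains two
diagonally opposite cells of `S` and no other cell, and `1` otherwise. The excess of a window is
`3 * (n - e + 2 * b) - 2`, where `n` is the number of cells of `S` in it, `e` that of pairs of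
adjacent cells of `S`, and `b` is `1` if all four cells belong to `S` and `0` otherwise. Summation
over all windows turns this into the Euler characteristic of `S`, which is at most `1` since `S` is
connected (`ConnDom.euler`). So the total excess is at most `6 * (#S + 1) - 2 * (p + 1) * (q + 1)`
(`ConnDom.total_le`), and it remains to bound the total excess from below.

Domination keeps the empty windows apart; for instance, no two of them touch diagonally. A
structure `Board` records what is needed. Three consecutive columns of windows have nonnegative
excess, unless their number of rows is `1` modulo `3` and the middle column is perfect, with empty
windows in all rows divisible by `3` (`Board.triple_nonneg`). If the number of columns of windows
is divisible by `3`, the total excess is thus nonnegative. If it is `1` modulo `3`, one column is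
left over, and this column is not entirely empty, since otherwise it would disconnect `S`
(`Board.total_gt_of_mod_one`). Perfect columns do no harm: a perfect column and a perfect row
exclude each other, so that the argument applies to the columns or to the rows.

There remains the case that both numbers of windows are `2` modulo `3`, where the total excess is
shown to be at least `-4` (`Board.neg_four_le_total`). Here each empty window is called horizontal
if it has a horizontal empty neighbour, else vertical. A vertical window then has no empty left and
right neighbour, and a horizontal one has no empty upper and lower neighbour. Up to the border, the
total excess counts the free windows, which are neither empty nor such a neighbour, and each
vertical window in the first or last column and each horizontal window in the first or last row
costs `1` (`Domino.sum_free_le`). Such a border window is the start of a train, a sequence of empty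
windows of the same type at distance three. A train cannot reach the opposite side, because of the
residue modulo `3`, and behind its end there is, as a rule, a free window, its target, which is
charged for the train. Some care is needed if the target is not free or is wanted by two trains
(`Domino.LeftCharge`); at most one train per side cannot be served (`Domino.Exceptional.unique`),
so the loss is at most `4`. Opposite trains with the same target are treated separately, by the
triples of columns or rows next to them (`Board.JogAt.total_ge`).
-/

/-! ### Indicators and a combinatorial lemma on integer sequences -/

namespace DomForcing

open Finset

/-- The indicator of a proposition, as an integer. -/
noncomputable def ind (a : Prop) : ℤ := by
  classical exact if a then 1 else 0

lemma ind_pos {a : Prop} (h : a) : ind a = 1 := by simp [ind, h]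

lemma ind_neg {a : Prop} (h : ¬ a) : ind a = 0 := by simp [ind, h]

lemma ind_nonneg (a : Prop) : 0 ≤ ind a := by unfold ind; split_ifs <;> simp

lemma ind_le_one (a : Prop) : ind a ≤ 1 := by unfold ind; split_ifs <;> simp

lemma ind_eq_one {a : Prop} : ind a = 1 ↔ a := by unfold ind; split_ifs <;> simp [*]

lemma ind_eq_zero {a : Prop} : ind a = 0 ↔ ¬ a := by unfold ind; split_ifs <;> simp [*]

/-- Here `e i` is the number of empty windows in row `i` of three consecutive columns, and `b i`
tells whether the middle window of the row is full or diagonal. The sum of `1 - e + b` is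
nonnegative unless `N` is `1` modulo `3` and all positions divisible by `3` have `e ≥ 2`.

The induction distinguishes two kinds of prefixes. In the first kind the pattern `3, 0, 0, 3, 0, 0,
…` has gone on so far (`Tr`), and the partial sum may be as small as `-2`. Once the pattern is
broken (`NT`), a partial sum that ends right after a position with `e ≥ 2` can be negative only if
all positions with `e ≥ 2` are still aligned with the multiples of `3` (`QT`), and one or two
positions with small `e` pay for the next large one. -/
theorem prefix_sum_nonneg (e b : ℤ → ℤ) (N : ℕ)
    (he0 : ∀ i, 0 ≤ e i) (he3 : ∀ i, e i ≤ 3) (hb : ∀ i, 0 ≤ b i)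
    (hneg : ∀ i < 0, e i = 0)
    (h1 : ∀ i, 2 ≤ e i → e (i + 1) = 0) (h1' : ∀ i, 2 ≤ e (i + 1) → e i = 0)
    (h2 : ∀ i, e i = 3 → e (i + 2) = 0) (h2' : ∀ i, e (i + 2) = 3 → e i = 0)
    (h22 : ∀ i, e i = 2 → e (i + 2) ≤ 1)
    (h4 : ∀ i, e i = 3 → e (i + 4) = 3 → 1 ≤ b (i + 2))
    (hfirst : e 1 ≤ 1) (hN : 2 ≤ N) (hlast : e (N - 2) ≤ 1) :
    0 ≤ ∑ i ∈ range N, (1 - e i + b i) ∨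
      (N % 3 = 1 ∧ ∀ j : ℕ, j < N → j % 3 = 0 → 2 ≤ e j) := by
  set A : ℕ → ℤ := fun n => ∑ i ∈ range n, (1 - e i + b i) with hA
  have hs : ∀ n : ℕ, A (n + 1) = A n + (1 - e n + b n) := fun n => by
    simp only [hA, sum_range_succ]
  let QT : ℕ → Prop := fun n => ∀ j : ℕ, j < n → j % 3 = 0 → 2 ≤ e j
  have hQ : ∀ n : ℕ, QT n → (n % 3 = 0 → 2 ≤ e n) → QT (n + 1) := by
    intro n h h' j hj hj3
    rcases Nat.lt_succ_iff_lt_or_eq.1 hj with h'' | rfl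
    · exact h j h'' hj3
    · exact h' hj3
  let Tr : ℕ → Prop := fun n => QT n ∧
    ((n % 3 = 1 ∧ e (n - 1) = 3 ∧ -2 ≤ A n)
      ∨ (n % 3 = 2 ∧ e (n - 2) = 3 ∧ e (n - 1) = 0 ∧ -1 ≤ A n)
      ∨ (n % 3 = 0 ∧ e (n - 3) = 3 ∧ e (n - 2) = 0 ∧ e (n - 1) = 0 ∧ b (n - 1) ≤ A n))
  let NT : ℕ → Prop := fun n =>
    (2 ≤ e (n - 1) → 0 ≤ A n ∨ (-1 ≤ A n ∧ n % 3 = 1 ∧ QT n)) ∧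
    (e (n - 1) = 1 → 0 ≤ A n) ∧
    (e (n - 1) = 0 → 2 ≤ e (n - 2) → 1 ≤ A n ∨ (0 ≤ A n ∧ n % 3 = 2 ∧ QT n)) ∧
    (e (n - 1) = 0 → e (n - 2) ≤ 1 → 1 ≤ A n) ∧
    (e (n - 1) = 0 → e (n - 2) = 0 → e n = 3 → 2 ≤ A n ∨ (n % 3 = 0 ∧ QT n))
  have key : ∀ n : ℕ, Tr (n + 1) ∨ NT (n + 1) := by
    intro n
    induction n with
    | zero =>
      have hA0 : A 0 = 0 := by simp [hA]
      have hA1 := hs 0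
      have h0 := hb 0
      have h0' := he0 0
      have h0'' := he3 0
      have hm := hneg (-1) (by norm_num)
      have hq : 2 ≤ e 0 → QT 1 := by
        intro h j hj _
        obtain rfl : j = 0 := by omega
        simpa using h
      simp only [Tr, NT, Nat.zero_add, Nat.cast_one, Nat.cast_zero] at hA1 ⊢
      norm_num
      grind
    | succ n ih =>
      have hA1 := hs (n + 1)
      have hq := hQ (n + 1)
      have a0 := he0 (n + 1 : ℕ)
      have a3 := he3 (n + 1 : ℕ)
      have b0 := hb (n + 1 : ℕ)
      have b0' := hb ((n + 1 : ℕ) - 1)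
      have c1 := h1 ((n + 1 : ℕ) - 1)
      have c1' := h1' ((n + 1 : ℕ) - 1)
      have c2 := h2 ((n + 1 : ℕ) - 2)
      have c2' := h2' ((n + 1 : ℕ) - 2)
      have c22 := h22 ((n + 1 : ℕ) - 2)
      have c4 := h4 ((n + 1 : ℕ) - 3)
      have a0' := he0 ((n + 1 : ℕ) - 1)
      have a0'' := he0 ((n + 1 : ℕ) - 2)
      have a3' := he3 ((n + 1 : ℕ) - 1)
      have a3'' := he3 ((n + 1 : ℕ) - 2)
      have r1 : ((n + 1 : ℕ) : ℤ) - 1 + 1 = (n + 1 : ℕ) := by ring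
      have r2 : ((n + 1 : ℕ) : ℤ) - 2 + 2 = (n + 1 : ℕ) := by ring
      have r3 : ((n + 1 : ℕ) : ℤ) - 3 + 4 = (n + 1 + 1 : ℕ) := by push_cast; ring
      have r4 : ((n + 1 : ℕ) : ℤ) - 3 + 2 = (n + 1 : ℕ) - 1 := by ring
      have r5 : ((n + 1 + 1 : ℕ) : ℤ) - 1 = (n + 1 : ℕ) := by push_cast; ring
      have r6 : ((n + 1 + 1 : ℕ) : ℤ) - 2 = (n + 1 : ℕ) - 1 := by push_cast; ring
      have r7 : ((n + 1 + 1 : ℕ) : ℤ) - 3 = (n + 1 : ℕ) - 2 := by push_cast; ring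
      rw [r1] at c1 c1'
      rw [r2] at c2 c2' c22
      rw [r3, r4] at c4
      simp only [Tr, NT, r5, r6, r7] at ih ⊢
      -- what remains is a finite case distinction over linear integer arithmetic
      generalize QT (n + 1 + 1) = q' at *
      generalize QT (n + 1) = q at *
      generalize e ((n + 1 : ℕ) - 1) = g1 at *
      generalize e ((n + 1 : ℕ) - 2) = g2 at *
      generalize e ((n + 1 : ℕ) - 3) = g3 at *
      generalize e ((n + 1 : ℕ)) = g0 at *
      generalize e ((n + 1 + 1 : ℕ)) = gp at *
      generalize A (n + 1 + 1) = A' at *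
      generalize A (n + 1) = A0 at *
      generalize b ((n + 1 : ℕ)) = b0 at *
      generalize b ((n + 1 : ℕ) - 1) = b1 at *
      clear hs hQ hb h1 h1' h2 h2' h22 h4 hneg he0 he3 r1 r2 r3 r4 r5 r6 r7 hlast hfirst
      clear Tr NT
      clear_value A QT
      clear hA A QT
      have hm : (n + 1) % 3 = 0 ∨ (n + 1) % 3 = 1 ∨ (n + 1) % 3 = 2 := by omega
      have hg : g0 = 0 ∨ g0 = 1 ∨ g0 = 2 ∨ g0 = 3 := by omega
      rcases hg with rfl | rfl | rfl | rfl <;> rcases ih with ih | ih <;>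
        rcases hm with hm | hm | hm <;> grind
  have := key (N - 1)
  rw [Nat.sub_add_cancel (by omega)] at this
  have a0 := he0 ((N : ℤ) - 1)
  rcases this with ⟨hq, h⟩ | ⟨k1, k2, k3, k4, k5⟩
  · rcases h with ⟨h, -, -⟩ | ⟨-, h, -⟩ | ⟨-, -, -, -, h⟩
    · exact Or.inr ⟨h, hq⟩
    · omega
    · exact Or.inl ((hb _).trans h)
  · by_cases h : 2 ≤ e ((N : ℤ) - 1)
    · rcases k1 h with h | ⟨-, h, h'⟩
      · exact Or.inl h
      · exact Or.inr ⟨h, h'⟩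
    · left
      by_cases h' : e ((N : ℤ) - 1) = 1
      · exact k2 h'
      · have h0 : e ((N : ℤ) - 1) = 0 := by omega
        by_cases h'' : 2 ≤ e ((N : ℤ) - 2)
        · omega
        · exact (zero_le_one).trans (k4 h0 (by omega))

end DomForcing

/-! ### Boards and the excess of three consecutive columns -/

namespace DomForcing

open Finset

/-- The window pattern of a dominating set in a grid. The windows `(i, x)`, `0 ≤ i < P`, `0 ≤ x <
Q`, are the `2 × 2` blocks of cells that meet the grid; `E i x` says that the block is disjoint from
the set, `Z i x` that it is either contained in the set or meets it in two diagonally opposite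
cells. The fields are the consequences of domination in the neighbourhood of empty blocks, together
with `no_col` and `no_row`: a column (row) of empty windows in the middle would cut a connected set
in two. -/
structure Board where
  P : ℕ
  Q : ℕ
  E : ℤ → ℤ → Prop
  Z : ℤ → ℤ → Prop
  range : ∀ {i x}, E i x → 0 ≤ i ∧ i < P ∧ 0 ≤ x ∧ x < Q
  diag : ∀ {i x}, E i x → E (i + 1) (x + 1) → False
  diag' : ∀ {i x}, E i (x + 1) → E (i + 1) x → False
  gap_h : ∀ {i x}, E i x → E i (x + 2) → E i (x + 1)
  gap_v : ∀ {i x}, E i x → E (i + 2) x → E (i + 1) x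
  left : ∀ {i}, E i 1 → E i 0
  right : ∀ {i}, E i (Q - 2) → E i (Q - 1)
  top : ∀ {x}, E 1 x → E 0 x
  bottom : ∀ {x}, E (P - 2) x → E (P - 1) x
  full_v : ∀ {i x}, E i x → E i (x + 1) → E i (x + 2) →
    E (i + 4) x → E (i + 4) (x + 1) → E (i + 4) (x + 2) → Z (i + 2) (x + 1)
  full_h : ∀ {i x}, E i x → E (i + 1) x → E (i + 2) x →
    E i (x + 4) → E (i + 1) (x + 4) → E (i + 2) (x + 4) → Z (i + 1) (x + 2)
  no_col : 7 ≤ Q → ¬ ∀ i : ℤ, 0 ≤ i → i < P → E i 3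
  no_row : 7 ≤ P → ¬ ∀ x : ℤ, 0 ≤ x → x < Q → E 3 x

namespace Board

/-- Reflection of a board in the main diagonal. -/
def transpose (M : Board) : Board where
  P := M.Q
  Q := M.P
  E i x := M.E x i
  Z i x := M.Z x i
  range h := by have := M.range h; omega
  diag h h' := M.diag h h'
  diag' h h' := M.diag' h' h
  gap_h := M.gap_v
  gap_v := M.gap_h
  left := M.top
  right := M.bottom
  top := M.left
  bottom := M.right
  full_v := M.full_h
  full_h := M.full_v
  no_col := M.no_row
  no_row := M.no_col

variable (M : Board)

/-- The excess of a window: `-2` for an empty one, `4` for a full or diagonal one, else `1`. -/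
noncomputable def val (i x : ℤ) : ℤ := 1 - 3 * ind (M.E i x) + 3 * ind (M.Z i x)

/-- The sum of the excesses over a column. -/
noncomputable def col (x : ℤ) : ℤ := ∑ i ∈ Finset.range M.P, M.val i x

/-- The sum of the excesses over a row. -/
noncomputable def row (i : ℤ) : ℤ := ∑ x ∈ Finset.range M.Q, M.val i x

/-- The sum of all excesses. -/
noncomputable def total : ℤ := ∑ x ∈ Finset.range M.Q, M.col x

lemma total_eq_sum_row : M.total = ∑ i ∈ Finset.range M.P, M.row i := by
  simp only [total, col, row]
  exact Finset.sum_comm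

lemma transpose_total : M.transpose.total = M.total := by
  rw [total_eq_sum_row M]
  rfl

lemma transpose_col (x : ℤ) : M.transpose.col x = M.row x := rfl

lemma middle_of_two_le {i y : ℤ}
    (h : 2 ≤ ind (M.E i y) + ind (M.E i (y + 1)) + ind (M.E i (y + 2))) :
    M.E i (y + 1) ∧ (M.E i y ∨ M.E i (y + 2)) := by
  have h0 := ind_le_one (M.E i y)
  have h1 := ind_le_one (M.E i (y + 1))
  have h2 := ind_le_one (M.E i (y + 2))
  have := @M.gap_h i y
  rw [← ind_eq_one (a := M.E i y), ← ind_eq_one (a := M.E i (y + 1)),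
    ← ind_eq_one (a := M.E i (y + 2))] at this ⊢
  omega

lemma not_below {i y : ℤ} (h : M.E i (y + 1)) (h' : M.E i y ∨ M.E i (y + 2)) :
    ¬ M.E (i + 1) y ∧ ¬ M.E (i + 1) (y + 1) ∧ ¬ M.E (i + 1) (y + 2) := by
  refine ⟨fun k => M.diag' h k, fun k => ?_, fun k => M.diag h (by rwa [add_assoc])⟩
  rcases h' with h' | h'
  · exact M.diag h' k
  · exact M.diag' (x := y + 1) (by rwa [add_assoc]) k

lemma not_above {i y : ℤ} (h : M.E (i + 1) (y + 1)) (h' : M.E (i + 1) y ∨ M.E (i + 1) (y + 2)) :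
    ¬ M.E i y ∧ ¬ M.E i (y + 1) ∧ ¬ M.E i (y + 2) := by
  refine ⟨fun k => M.diag k h, fun k => ?_, fun k => M.diag' (x := y + 1) (by rwa [add_assoc]) h⟩
  rcases h' with h' | h'
  · exact M.diag' k h'
  · exact M.diag k (by rwa [add_assoc])

/-- Three consecutive columns have nonnegative excess unless the number of rows is `1` modulo `3`
and the middle column has empty windows, with an empty horizontal neighbour, in all rows divisible
by `3`. -/
theorem triple_nonneg (hP : 2 ≤ M.P) (y : ℤ) :
    0 ≤ ∑ i ∈ Finset.range M.P, (1 - (ind (M.E i y) + ind (M.E i (y + 1)) + ind (M.E i (y + 2)))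
      + ind (M.Z i (y + 1))) ∨
    (M.P % 3 = 1 ∧ ∀ i : ℤ, 0 ≤ i → i < M.P → i % 3 = 0 →
      M.E i (y + 1) ∧ (M.E i y ∨ M.E i (y + 2))) := by
  have hz : ∀ i, ¬ M.E i y → ¬ M.E i (y + 1) → ¬ M.E i (y + 2) →
      ind (M.E i y) + ind (M.E i (y + 1)) + ind (M.E i (y + 2)) = 0 := by
    intro i a b c
    simp [ind_neg a, ind_neg b, ind_neg c]
  have h1 : ∀ i, 2 ≤ ind (M.E i y) + ind (M.E i (y + 1)) + ind (M.E i (y + 2)) →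
      ind (M.E (i + 1) y) + ind (M.E (i + 1) (y + 1)) + ind (M.E (i + 1) (y + 2)) = 0 := by
    intro i h
    obtain ⟨a, b⟩ := M.middle_of_two_le h
    obtain ⟨c, d, e⟩ := M.not_below a b
    exact hz _ c d e
  have h1' : ∀ i,
      2 ≤ ind (M.E (i + 1) y) + ind (M.E (i + 1) (y + 1)) + ind (M.E (i + 1) (y + 2)) →
      ind (M.E i y) + ind (M.E i (y + 1)) + ind (M.E i (y + 2)) = 0 := by
    intro i h
    obtain ⟨a, b⟩ := M.middle_of_two_le h
    obtain ⟨c, d, e⟩ := M.not_above a b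
    exact hz _ c d e
  have hI : ∀ i x, 0 ≤ ind (M.E i x) ∧ ind (M.E i x) ≤ 1 := fun i x =>
    ⟨ind_nonneg _, ind_le_one _⟩
  -- two rows at distance two share no column as soon as one of the rows has two empty windows
  have hsh : ∀ i x, (x = y ∨ x = y + 1 ∨ x = y + 2) →
      2 ≤ ind (M.E i y) + ind (M.E i (y + 1)) + ind (M.E i (y + 2)) ∨
      2 ≤ ind (M.E (i + 2) y) + ind (M.E (i + 2) (y + 1)) + ind (M.E (i + 2) (y + 2)) →
      ind (M.E i x) + ind (M.E (i + 2) x) ≤ 1 := by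
    intro i x hx h
    have h0 : ind (M.E (i + 1) x) = 0 := by
      have h' : ind (M.E (i + 1) y) + ind (M.E (i + 1) (y + 1))
          + ind (M.E (i + 1) (y + 2)) = 0 := by
        rcases h with h | h
        · exact h1 i h
        · exact h1' (i + 1) (by rwa [show i + 1 + 1 = i + 2 by ring])
      have := hI (i + 1) y
      have := hI (i + 1) (y + 1)
      have := hI (i + 1) (y + 2)
      rcases hx with rfl | rfl | rfl <;> omega
    have := hI i x
    have := hI (i + 2) x
    by_contra hc
    have ha : ind (M.E i x) = 1 := by omega
    have hb : ind (M.E (i + 2) x) = 1 := by omega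
    exact (ind_eq_zero.1 h0) (M.gap_v (ind_eq_one.1 ha) (ind_eq_one.1 hb))
  have hout : ∀ i x, i < 0 ∨ (M.P : ℤ) ≤ i → ¬ M.E i x := by
    intro i x h h'
    have := M.range h'
    omega
  refine (prefix_sum_nonneg
      (fun i => ind (M.E i y) + ind (M.E i (y + 1)) + ind (M.E i (y + 2)))
      (fun i => ind (M.Z i (y + 1))) M.P ?_ ?_ (fun _ => ind_nonneg _) ?_ h1 h1'
      ?_ ?_ ?_ ?_ ?_ hP ?_).imp id
    fun ⟨h, h'⟩ => ⟨h, fun i hi hi' hi3 => ?_⟩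
  · intro i
    have := hI i y
    have := hI i (y + 1)
    have := hI i (y + 2)
    omega
  · intro i
    have := hI i y
    have := hI i (y + 1)
    have := hI i (y + 2)
    omega
  · intro i hi
    exact hz _ (hout _ _ (Or.inl hi)) (hout _ _ (Or.inl hi)) (hout _ _ (Or.inl hi))
  · intro i h
    have k := hsh i y (by simp) (Or.inl (by omega))
    have k1 := hsh i (y + 1) (by simp) (Or.inl (by omega))
    have k2 := hsh i (y + 2) (by simp) (Or.inl (by omega))
    have := hI (i + 2) y
    have := hI (i + 2) (y + 1)
    have := hI (i + 2) (y + 2)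
    omega
  · intro i h
    have k := hsh i y (by simp) (Or.inr (by omega))
    have k1 := hsh i (y + 1) (by simp) (Or.inr (by omega))
    have k2 := hsh i (y + 2) (by simp) (Or.inr (by omega))
    have := hI i y
    have := hI i (y + 1)
    have := hI i (y + 2)
    omega
  · intro i h
    have k := hsh i y (by simp) (Or.inl (by omega))
    have k1 := hsh i (y + 1) (by simp) (Or.inl (by omega))
    have k2 := hsh i (y + 2) (by simp) (Or.inl (by omega))
    omega
  · intro i h h'
    have := hI i y
    have := hI i (y + 1)
    have := hI i (y + 2)
    have := hI (i + 4) y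
    have := hI (i + 4) (y + 1)
    have := hI (i + 4) (y + 2)
    rw [ind_pos (M.full_v (ind_eq_one.1 (by omega)) (ind_eq_one.1 (by omega))
      (ind_eq_one.1 (by omega)) (ind_eq_one.1 (by omega)) (ind_eq_one.1 (by omega))
      (ind_eq_one.1 (by omega)))]
  · by_contra h
    obtain ⟨a, b⟩ := M.middle_of_two_le (i := 1) (y := y) (by omega)
    have := M.not_above (i := 0) (y := y) (by simpa using a) (by simpa using b)
    exact this.2.1 (M.top a)
  · by_contra h
    obtain ⟨a, b⟩ := M.middle_of_two_le (i := M.P - 2) (y := y) (by omega)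
    have := M.not_below a b
    rw [show (M.P : ℤ) - 2 + 1 = M.P - 1 by ring] at this
    exact this.2.1 (M.bottom a)
  · lift i to ℕ using hi
    exact M.middle_of_two_le (h' i (by omega) (by omega))

/-- A column all of whose windows in rows divisible by `3` are empty and have an empty horizontal
neighbour. -/
def PerfectCol (x : ℤ) : Prop :=
  ∀ i : ℤ, 0 ≤ i → i < M.P → i % 3 = 0 → M.E i x ∧ (M.E i (x - 1) ∨ M.E i (x + 1))

/-- The excess of three columns, where the windows with `Z` in the outer columns count in
addition. -/
theorem three_col_ge (hP : 2 ≤ M.P) (y : ℤ) (h : M.P % 3 = 1 → ¬ M.PerfectCol (y + 1)) :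
    3 * ∑ i ∈ Finset.range M.P, (ind (M.Z i y) + ind (M.Z i (y + 2)))
      ≤ M.col y + M.col (y + 1) + M.col (y + 2) := by
  rcases M.triple_nonneg hP y with h' | ⟨h1, h2⟩
  · have : M.col y + M.col (y + 1) + M.col (y + 2)
        = 3 * ∑ i ∈ Finset.range M.P, (1 - (ind (M.E i y) + ind (M.E i (y + 1))
          + ind (M.E i (y + 2))) + ind (M.Z i (y + 1)))
          + 3 * ∑ i ∈ Finset.range M.P, (ind (M.Z i y) + ind (M.Z i (y + 2))) := by
      simp only [col, val, ← sum_add_distrib, mul_sum]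
      refine sum_congr rfl fun i _ => by ring
    linarith
  · refine absurd ?_ (h h1)
    intro i a b c
    have := h2 i a b c
    rwa [show y + 1 - 1 = y by ring, show y + 1 + 1 = y + 2 by ring]

theorem three_col_nonneg (hP : 2 ≤ M.P) (y : ℤ) (h : M.P % 3 = 1 → ¬ M.PerfectCol (y + 1)) :
    0 ≤ M.col y + M.col (y + 1) + M.col (y + 2) := by
  refine le_trans ?_ (M.three_col_ge hP y h)
  exact mul_nonneg (by norm_num) (sum_nonneg fun i _ => add_nonneg (ind_nonneg _) (ind_nonneg _))

/-- Sums over `3k` consecutive columns are nonnegative. -/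
theorem cols_nonneg (hP : 2 ≤ M.P) (h : M.P % 3 = 1 → ∀ y, ¬ M.PerfectCol y) (y : ℤ) (k : ℕ) :
    0 ≤ ∑ x ∈ Finset.range (3 * k), M.col (y + x) := by
  induction k with
  | zero => simp
  | succ k ih =>
    rw [show 3 * (k + 1) = 3 * k + 1 + 1 + 1 by ring, sum_range_succ, sum_range_succ,
      sum_range_succ]
    have := M.three_col_nonneg hP (y + (3 * k : ℕ)) fun h' => h h' _
    push_cast at this ih ⊢
    simp only [← add_assoc] at this ⊢
    linarith

/-- With the columns split into `3a`, `m` and `3b` columns, the `m` columns in the middle bound the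
total excess, as the other ones form triples. -/
theorem total_ge (hP : 2 ≤ M.P) (h : M.P % 3 = 1 → ∀ y, ¬ M.PerfectCol y) (a m b : ℕ)
    (hQ : M.Q = 3 * a + m + 3 * b) :
    ∑ x ∈ Finset.range m, M.col ((3 * a : ℕ) + x) ≤ M.total := by
  rw [total, hQ, sum_range_add, sum_range_add]
  have h1 := M.cols_nonneg hP h 0 a
  have h2 := M.cols_nonneg hP h ((3 * a + m : ℕ)) b
  push_cast at h1 h2 ⊢
  simp only [zero_add] at h1
  linarith

lemma neg_two_le_val (i x : ℤ) : -2 ≤ M.val i x := by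
  have := ind_le_one (M.E i x)
  have := ind_nonneg (M.Z i x)
  unfold val
  linarith

lemma val_of_not_E {i x : ℤ} (h : ¬ M.E i x) : 1 ≤ M.val i x := by
  have := ind_nonneg (M.Z i x)
  rw [val, ind_neg h]
  linarith

/-- If the number of columns is `1` modulo `3`, then the triples leave over one column, say the
fourth one, and not all windows of this column are empty. -/
theorem total_gt_of_mod_one (hP : 2 ≤ M.P) (h : M.P % 3 = 1 → ∀ y, ¬ M.PerfectCol y)
    (hQ : M.Q % 3 = 1) (hQ5 : 5 ≤ M.Q) : -2 * (M.P : ℤ) < M.total := by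
  have h1 := M.total_ge hP h 1 1 (M.Q / 3 - 1) (by omega)
  simp only [sum_range_one] at h1
  refine lt_of_lt_of_le ?_ h1
  push_cast
  have h2 := M.no_col (by omega)
  push Not at h2
  obtain ⟨i, hi, hi', hE⟩ := h2
  lift i to ℕ using hi
  have hlt : ∑ j ∈ Finset.range M.P, (-2 : ℤ) < ∑ j ∈ Finset.range M.P, M.val j 3 := by
    refine sum_lt_sum (fun j _ => M.neg_two_le_val j 3) ⟨i, by simpa using hi', ?_⟩
    have := M.val_of_not_E hE
    linarith
  rw [sum_const, card_range, nsmul_eq_mul] at hlt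
  simp only [col]
  simpa [mul_comm] using hlt

/-- If the number of columns is divisible by `3`, the columns split into triples. -/
theorem total_nonneg_of_mod_zero (hP : 2 ≤ M.P) (hP1 : M.P % 3 ≠ 1) (hQ : M.Q % 3 = 0) :
    0 ≤ M.total := by
  simpa using M.total_ge hP (fun h => absurd h hP1) 0 0 (M.Q / 3) (by omega)

/-- A perfect column and a perfect row collide where they cross. -/
theorem not_perfectCol_of_perfectRow (hP : M.P % 3 = 1) (hQ : M.Q % 3 = 1) {x r : ℤ}
    (hx : M.PerfectCol x) (hr : M.transpose.PerfectCol r) : False := by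
  have key : ∀ i x r y : ℤ, (M.E i x ∧ (M.E i (x - 1) ∨ M.E i (x + 1))) →
      (M.E r y ∧ (M.E (r - 1) y ∨ M.E (r + 1) y)) → r - i ≤ 1 → i - r ≤ 1 → x - y ≤ 1 → y - x ≤ 1 →
      False := by
    intro i x r y h1 h2 a b c d
    have d1 : ∀ {i j x y}, M.E i x → M.E j y → j = i + 1 → y = x + 1 → False := by
      rintro i j x y h h' rfl rfl
      exact M.diag h h'
    have d2 : ∀ {i j x y}, M.E i x → M.E j y → j = i + 1 → x = y + 1 → False := by
      rintro i j x y h h' rfl rfl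
      exact M.diag' h h'
    obtain ⟨h1, h1'⟩ := h1
    obtain ⟨h2, h2'⟩ := h2
    rcases (by omega : r = i + 1 ∨ r = i ∨ i = r + 1) with hr | hr | hr
    · rcases (by omega : y = x + 1 ∨ y = x ∨ x = y + 1) with hy | hy | hy
      · exact d1 h1 h2 hr hy
      · rcases h1' with h1' | h1'
        · exact d1 h1' h2 (by omega) (by omega)
        · exact d2 h1' h2 (by omega) (by omega)
      · exact d2 h1 h2 hr hy
    · rcases (by omega : y = x + 1 ∨ y = x ∨ x = y + 1) with hy | hy | hy
      · rcases h2' with h2' | h2'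
        · exact d2 h2' h1 (by omega) (by omega)
        · exact d1 h1 h2' (by omega) (by omega)
      · rcases h1' with h1' | h1' <;> rcases h2' with h2' | h2'
        · exact d2 h2' h1' (by omega) (by omega)
        · exact d1 h1' h2' (by omega) (by omega)
        · exact d1 h2' h1' (by omega) (by omega)
        · exact d2 h1' h2' (by omega) (by omega)
      · rcases h2' with h2' | h2'
        · exact d1 h2' h1 (by omega) (by omega)
        · exact d2 h1 h2' (by omega) (by omega)
    · rcases (by omega : y = x + 1 ∨ y = x ∨ x = y + 1) with hy | hy | hy
      · exact d2 h2 h1 hr (by omega)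
      · rcases h1' with h1' | h1'
        · exact d2 h2 h1' (by omega) (by omega)
        · exact d1 h2 h1' (by omega) (by omega)
      · exact d1 h2 h1 hr (by omega)
  have hx0 := M.range (hx 0 le_rfl (by omega) rfl).1
  have hr0 := M.range (i := r) (x := 0) 
    (hr 0 le_rfl (by have : M.transpose.P = M.Q := rfl; omega) rfl).1
  -- both numbers of windows are `1` modulo `3`, so a multiple of `3` is within distance one
  obtain ⟨i, hi, hi', hi3, hir, hir'⟩ :
      ∃ i : ℤ, 0 ≤ i ∧ i < M.P ∧ i % 3 = 0 ∧ r - i ≤ 1 ∧ i - r ≤ 1 :=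
    ⟨3 * ((r + 1) / 3), by omega, by omega, by omega, by omega, by omega⟩
  obtain ⟨y, hy, hy', hy3, hyx, hyx'⟩ :
      ∃ y : ℤ, 0 ≤ y ∧ y < M.Q ∧ y % 3 = 0 ∧ x - y ≤ 1 ∧ y - x ≤ 1 :=
    ⟨3 * ((x + 1) / 3), by omega, by omega, by omega, by omega, by omega⟩
  exact key i x r y (hx i hi hi' hi3) (hr y hy hy' hy3) hir hir' hyx hyx'

end Board

end DomForcing

/-! ### Trains and the windows they charge -/

namespace DomForcing

/-- A board with both side lengths `2` modulo `3` whose empty windows are sorted into vertical ones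
(`V`), which have no horizontal empty neighbour, and horizontal ones (`H`), which have no vertical
empty neighbour. The fields list the relative positions that cannot occur. -/
structure Domino where
  P : ℕ
  Q : ℕ
  hP : P % 3 = 2
  hQ : Q % 3 = 2
  V : ℤ → ℤ → Prop
  H : ℤ → ℤ → Prop
  V_range : ∀ {i x}, V i x → 0 ≤ i ∧ i < P ∧ 0 ≤ x ∧ x < Q
  H_range : ∀ {i x}, H i x → 0 ≤ i ∧ i < P ∧ 0 ≤ x ∧ x < Q
  VV : ∀ {i x j y}, V i x → V j y →
    (j = i ∧ (y = x + 1 ∨ y = x + 2)) ∨ (j = i + 1 ∧ (y = x + 1 ∨ y = x - 1)) → False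
  HH : ∀ {i x j y}, H i x → H j y →
    (y = x ∧ (j = i + 1 ∨ j = i + 2)) ∨ (j = i + 1 ∧ (y = x + 1 ∨ y = x - 1)) → False
  VH : ∀ {i x j y}, V i x → H j y →
    (-1 ≤ j - i ∧ j - i ≤ 1 ∧ -1 ≤ y - x ∧ y - x ≤ 1) ∨ (j = i ∧ -2 ≤ y - x ∧ y - x ≤ 2) ∨
      (y = x ∧ -2 ≤ j - i ∧ j - i ≤ 2) → False
  V_gap : ∀ {i x}, V i x → V (i + 2) x → V (i + 1) x
  H_gap : ∀ {i x}, H i x → H i (x + 2) → H i (x + 1)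
  V_left : ∀ {i}, ¬ V i 1
  V_right : ∀ {i}, ¬ V i (Q - 2)
  H_top : ∀ {x}, ¬ H 1 x
  H_bottom : ∀ {x}, ¬ H (P - 2) x

namespace Domino

/-- Reflection in the main diagonal; it exchanges vertical and horizontal windows. -/
def transpose (M : Domino) : Domino where
  P := M.Q
  Q := M.P
  hP := M.hQ
  hQ := M.hP
  V i x := M.H x i
  H i x := M.V x i
  V_range h := by have := M.H_range h; omega
  H_range h := by have := M.V_range h; omega
  VV h h' k := by
    rcases k with k | ⟨k, k' | k'⟩
    · exact M.HH h h' (by omega)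
    · exact M.HH h h' (by omega)
    · exact M.HH h' h (by omega)
  HH h h' k := by
    rcases k with k | ⟨k, k' | k'⟩
    · exact M.VV h h' (by omega)
    · exact M.VV h h' (by omega)
    · exact M.VV h' h (by omega)
  VH h h' k := M.VH h' h (by omega)
  V_gap := M.H_gap
  H_gap := M.V_gap
  V_left := M.H_top
  V_right := M.H_bottom
  H_top := M.V_left
  H_bottom := M.V_right

/-- Reflection that reverses the order of the columns. -/
def flipX (M : Domino) : Domino where
  P := M.P
  Q := M.Q
  hP := M.hP
  hQ := M.hQ
  V i x := M.V i (M.Q - 1 - x)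
  H i x := M.H i (M.Q - 1 - x)
  V_range h := by have := M.V_range h; omega
  H_range h := by have := M.H_range h; omega
  VV h h' k := by
    rcases k with k | k
    · exact M.VV h' h (by omega)
    · exact M.VV h h' (by omega)
  HH h h' k := M.HH h h' (by omega)
  VH h h' k := M.VH h h' (by omega)
  V_gap := M.V_gap
  H_gap {i x} h h' := by
    have := @M.H_gap i (M.Q - 1 - (x + 2)) h'
    rw [show (M.Q : ℤ) - 1 - (x + 2) + 2 = M.Q - 1 - x by ring,
      show (M.Q : ℤ) - 1 - (x + 2) + 1 = M.Q - 1 - (x + 1) by ring] at this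
    exact this h
  V_left {i} h := M.V_right (i := i) (by rwa [show (M.Q : ℤ) - 1 - 1 = M.Q - 2 by ring] at h)
  V_right {i} h := M.V_left (i := i)
    (by rwa [show (M.Q : ℤ) - 1 - (M.Q - 2) = 1 by ring] at h)
  H_top := M.H_top
  H_bottom := M.H_bottom

/-- Reflection that reverses the order of the rows. -/
def flipY (M : Domino) : Domino := M.transpose.flipX.transpose

variable (M : Domino)

lemma flipY_flipY : M.flipY.flipY = M := by
  cases M
  simp [flipY, transpose, flipX]

/-- A free window: it is not empty, not a horizontal neighbour of a vertical window and not a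
vertical neighbour of a horizontal window. -/
def Free (r c : ℤ) : Prop :=
  0 ≤ r ∧ r < M.P ∧ 0 ≤ c ∧ c < M.Q ∧ ¬ M.V r c ∧ ¬ M.H r c ∧ ¬ M.V r (c - 1) ∧ ¬ M.V r (c + 1) ∧
    ¬ M.H (r - 1) c ∧ ¬ M.H (r + 1) c

/-- The left train of row `i` ends in column `x`: the vertical windows in the columns `0, 3, 6, …`
of row `i` reach up to column `x`, and no further. -/
def LEnd (i x : ℤ) : Prop :=
  0 ≤ x ∧ x % 3 = 0 ∧ (∀ k, 0 ≤ k → k ≤ x → k % 3 = 0 → M.V i k) ∧ ¬ M.V i (x + 3)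

/-- The top train of column `j` ends in row `r`: the horizontal windows in the rows `0, 3, 6, …` of
column `j` reach down to row `r`, and no further. -/
def TEnd (j r : ℤ) : Prop := M.transpose.LEnd j r

/-- The bottom train of column `j` ends in row `r`: the horizontal windows in the rows
`P - 1, P - 4, …` of column `j` reach up to row `r`, and no further. -/
def BEnd (j r : ℤ) : Prop := M.flipY.transpose.LEnd j (M.P - 1 - r)

variable {M}

lemma LEnd.V {i x : ℤ} (h : M.LEnd i x) : M.V i x := h.2.2.1 x h.1 le_rfl h.2.1

lemma LEnd.mod {i x : ℤ} (h : M.LEnd i x) : x % 3 = 0 := h.2.1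

lemma TEnd.H {j r : ℤ} (h : M.TEnd j r) : M.H r j := LEnd.V h

lemma TEnd.mod {j r : ℤ} (h : M.TEnd j r) : r % 3 = 0 := LEnd.mod h

lemma BEnd.H {j r : ℤ} (h : M.BEnd j r) : M.H r j := by
  have : M.H (M.P - 1 - (M.P - 1 - r)) j := LEnd.V h
  rwa [sub_sub_cancel] at this

lemma BEnd.mod {j r : ℤ} (h : M.BEnd j r) : r % 3 = 1 := by
  have := LEnd.mod h
  have := M.hP
  omega

lemma TEnd_flipY {j r : ℤ} : M.flipY.TEnd j r ↔ M.BEnd j (M.P - 1 - r) := by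
  unfold BEnd
  rw [sub_sub_cancel]
  rfl

lemma BEnd_flipY {j r : ℤ} : M.flipY.BEnd j r ↔ M.TEnd j (M.P - 1 - r) := by
  unfold BEnd
  rw [flipY_flipY]
  rfl

/-- The last column is `1` modulo `3`, and the last but one column has no vertical window, so the
train stops well before the right side. -/
lemma LEnd.le {i x : ℤ} (h : M.LEnd i x) : x + 5 ≤ M.Q := by
  have h1 := M.V_range h.V
  have h2 := M.hQ
  have h3 := h.mod
  by_contra h4
  refine M.V_right (i := i) ?_
  rw [show (M.Q : ℤ) - 2 = x by omega]
  exact h.V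

/-- A train starts at every vertical window in column `0`. -/
lemma exists_LEnd {i : ℤ} (h : M.V i 0) : ∃ x, M.LEnd i x := by
  by_contra hc
  push Not at hc
  have key : ∀ n : ℕ, ∀ k : ℕ, k ≤ n → M.V i (3 * k) := by
    intro n
    induction n with
    | zero => intro k hk; obtain rfl : k = 0 := by omega
              simpa using h
    | succ n ih =>
      intro k hk
      rcases Nat.le_succ_iff.1 hk with hk | rfl
      · exact ih k hk
      · by_contra hv
        refine hc (3 * n) ⟨by positivity, by omega, fun k hk hk' hk3 => ?_, ?_⟩
        · lift k to ℕ using hk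
          have := ih (k / 3) (by omega)
          rwa [show (3 : ℤ) * (k / 3 : ℕ) = k by omega] at this
        · rwa [show 3 * (n : ℤ) + 3 = 3 * ((n + 1 : ℕ) : ℤ) by push_cast; ring]
  have := M.V_range (key M.Q M.Q le_rfl)
  omega

variable (M)

/-- The left train of row `i`, which ends in column `x`, has the target `(i, x + 2)`. This window is
already charged by the top train of column `x + 3`: that train ends in row `i - 1` and its own
target `(i + 1, x + 3)` is next to the vertical empty window `(i + 1, x + 2)`. -/
def FarTop (i x : ℤ) : Prop := M.TEnd (x + 3) (i - 1) ∧ M.V (i + 1) (x + 2)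

/-- The mirror image of `FarTop`: the target of the left train is already charged by the bottom
train of column `x + 3`. -/
def FarBottom (i x : ℤ) : Prop := M.BEnd (x + 3) (i + 1) ∧ M.V (i - 1) (x + 2)

/-- The top train of column `x + 2` has the same target `(i, x + 2)` as the left train of row
`i`. -/
def SameTop (i x : ℤ) : Prop := M.TEnd (x + 2) (i - 2)

/-- The bottom train of column `x + 2` has the same target `(i, x + 2)` as the left train of
row `i`. -/
def SameBottom (i x : ℤ) : Prop := M.BEnd (x + 2) (i + 2)

/-- The left train of row `i` charges the free window `(r, c)`. If the train ends in column `x`, its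
target is `(i, x + 2)`, and this is what it charges unless one of the following happens.
* The target is next to a horizontal empty window `(r, x + 2)` above or below it. Then the train
  charges `(r, x + 1)`.
* The target is charged by a top or bottom train for the transposed reason (`FarTop`, `FarBottom`).
  Then the train charges the window above or below its own end `(i, x)`; this fails if that window
  is the target of yet another train, see `Exceptional`.
* The target is also the target of a top or bottom train (`SameTop`, `SameBottom`), and `sp` holds,
  which says that the trains from the left give way. Then one of two windows near the end of that
  other train is free. -/
def LeftCharge (sp : Prop) (i r c : ℤ) : Prop := M.Free r c ∧ ∃ x, M.LEnd i x ∧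
  ((c = x + 1 ∧ (r = i + 1 ∨ r = i - 1) ∧ M.H r (x + 2)) ∨
  (r = i - 1 ∧ c = x ∧ M.FarBottom i x ∧ ¬ M.TEnd x (i - 3)) ∨
  (r = i + 1 ∧ c = x ∧ M.FarTop i x ∧ ¬ M.BEnd x (i + 3)) ∨
  (r = i ∧ c = x + 2 ∧ ¬ M.FarTop i x ∧ ¬ M.FarBottom i x ∧
    (sp → ¬ M.SameTop i x ∧ ¬ M.SameBottom i x)) ∨
  (sp ∧ M.SameTop i x ∧ ((r = i - 2 ∧ c = x ∧ (M.V (i - 1) x ∨ M.H (i - 2) (x + 1))) ∨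
    (r = i - 1 ∧ c = x + 1))) ∨
  (sp ∧ M.SameBottom i x ∧ ((r = i + 2 ∧ c = x ∧ (M.V (i + 1) x ∨ M.H (i + 2) (x + 1))) ∨
    (r = i + 1 ∧ c = x + 1))))

/-- The left train of row `i` finds its target charged by a bottom (top) train, while the window
above (below) its own end is the target of a top (bottom) train. -/
def Exceptional (i : ℤ) : Prop := ∃ x, M.LEnd i x ∧
  ((M.FarBottom i x ∧ M.TEnd x (i - 3)) ∨ (M.FarTop i x ∧ M.BEnd x (i + 3)))

variable {M}

lemma LeftCharge.flipY {sp : Prop} {i r c : ℤ} (h : M.LeftCharge sp i r c) :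
    M.flipY.LeftCharge sp (M.P - 1 - i) (M.P - 1 - r) c := by
  have hV : ∀ a b, M.flipY.V a b = M.V (M.P - 1 - a) b := fun _ _ => rfl
  have hH : ∀ a b, M.flipY.H a b = M.H (M.P - 1 - a) b := fun _ _ => rfl
  have hP : M.flipY.P = M.P := rfl
  have hQ : M.flipY.Q = M.Q := rfl
  have s0 : ∀ i : ℤ, (M.P : ℤ) - 1 - (M.P - 1 - i) = i := fun i => by ring
  have s1 : ∀ i k : ℤ, (M.P : ℤ) - 1 - (M.P - 1 - i - k) = i + k := fun i k => by ring
  have s2 : ∀ i k : ℤ, (M.P : ℤ) - 1 - (M.P - 1 - i + k) = i - k := fun i k => by ring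
  obtain ⟨hf, x, hx, h⟩ := h
  refine ⟨?_, x, ?_, ?_⟩
  · unfold Free at hf ⊢
    simp only [hV, hH, hP, hQ, s0, s1, s2]
    obtain ⟨h1, h2, h3, h4, h5, h6, h7, h8, h9, h10⟩ := hf
    exact ⟨by omega, by omega, h3, h4, h5, h6, h7, h8, h10, h9⟩
  · unfold LEnd at hx ⊢
    simpa only [hV, s0] using hx
  · simp only [FarTop, FarBottom, SameTop, SameBottom, TEnd_flipY, BEnd_flipY, hV, hH, s0, s1,
      s2] at h ⊢
    rcases h with ⟨h1, h2, h3⟩ | ⟨h1, h2, h3, h4⟩ | ⟨h1, h2, h3, h4⟩ | ⟨h1, h2, h3, h4, h5⟩ |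
      ⟨h1, h2, ⟨h3, h4⟩ | ⟨h3, h4⟩⟩ | ⟨h1, h2, ⟨h3, h4⟩ | ⟨h3, h4⟩⟩
    · exact Or.inl ⟨h1, by omega, h3⟩
    · exact Or.inr (Or.inr (Or.inl ⟨by omega, h2, h3, h4⟩))
    · exact Or.inr (Or.inl ⟨by omega, h2, h3, h4⟩)
    · exact Or.inr (Or.inr (Or.inr (Or.inl ⟨by omega, h2, h4, h3, fun h => (h5 h).symm⟩)))
    · exact Or.inr (Or.inr (Or.inr (Or.inr (Or.inr ⟨h1, h2, Or.inl ⟨by omega, h4⟩⟩))))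
    · exact Or.inr (Or.inr (Or.inr (Or.inr (Or.inr ⟨h1, h2, Or.inr ⟨by omega, h4⟩⟩))))
    · exact Or.inr (Or.inr (Or.inr (Or.inr (Or.inl ⟨h1, h2, Or.inl ⟨by omega, h4⟩⟩))))
    · exact Or.inr (Or.inr (Or.inr (Or.inr (Or.inl ⟨h1, h2, Or.inr ⟨by omega, h4⟩⟩))))

/-- Every left train that is not exceptional charges a free window. -/
theorem exists_leftCharge (sp : Prop) {i : ℤ} (h : M.V i 0) (he : ¬ M.Exceptional i) :
    ∃ r c, M.LeftCharge sp i r c := by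
  obtain ⟨x, hx⟩ := exists_LEnd h
  have hV := hx.V
  have hV3 := hx.2.2.2
  have hle := hx.le
  have h1 := M.V_range hV
  have hr := @M.H_range
  have hr' := @M.V_range
  have hVV := @M.VV
  have hVH := @M.VH
  have hHH := @M.HH
  by_cases hd : ∃ r, (r = i + 1 ∨ r = i - 1) ∧ M.H r (x + 2)
  · obtain ⟨r, hr1, hr2⟩ := hd
    refine ⟨r, x + 1, ⟨?_, x, hx, Or.inl ⟨rfl, hr1, hr2⟩⟩⟩
    have := hr hr2
    refine ⟨by omega, by omega, by omega, by omega, ?_⟩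
    grind
  by_cases hFB : M.FarBottom i x
  · refine ⟨i - 1, x, ⟨?_, x, hx, Or.inr (Or.inl
      ⟨rfl, rfl, hFB, fun h => he ⟨x, hx, Or.inl ⟨hFB, h⟩⟩⟩)⟩⟩
    have := hr' hFB.2
    have := hFB.2
    refine ⟨by omega, by omega, by omega, by omega, ?_⟩
    grind
  by_cases hFT : M.FarTop i x
  · refine ⟨i + 1, x, ⟨?_, x, hx, Or.inr (Or.inr (Or.inl
      ⟨rfl, rfl, hFT, fun h => he ⟨x, hx, Or.inr ⟨hFT, h⟩⟩⟩))⟩⟩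
    have := hr' hFT.2
    have := hFT.2
    refine ⟨by omega, by omega, by omega, by omega, ?_⟩
    grind
  by_cases hs : sp ∧ M.SameTop i x
  · obtain ⟨hs, hS⟩ := hs
    have k := hS.H
    have := hr k
    by_cases hv : M.V (i - 1) x ∨ M.H (i - 2) (x + 1)
    · refine ⟨i - 2, x, ⟨?_, x, hx, Or.inr (Or.inr (Or.inr (Or.inr (Or.inl
        ⟨hs, hS, Or.inl ⟨rfl, rfl, hv⟩⟩))))⟩⟩
      refine ⟨by omega, by omega, by omega, by omega, ?_⟩
      rcases hv with hv | hv
      · grind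
      · grind
    · refine ⟨i - 1, x + 1, ⟨?_, x, hx, Or.inr (Or.inr (Or.inr (Or.inr (Or.inl
        ⟨hs, hS, Or.inr ⟨rfl, rfl⟩⟩))))⟩⟩
      refine ⟨by omega, by omega, by omega, by omega, ?_⟩
      grind
  by_cases hs : sp ∧ M.SameBottom i x
  · obtain ⟨hs, hS⟩ := hs
    have k := hS.H
    have := hr k
    by_cases hv : M.V (i + 1) x ∨ M.H (i + 2) (x + 1)
    · refine ⟨i + 2, x, ⟨?_, x, hx, Or.inr (Or.inr (Or.inr (Or.inr (Or.inr
        ⟨hs, hS, Or.inl ⟨rfl, rfl, hv⟩⟩))))⟩⟩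
      refine ⟨by omega, by omega, by omega, by omega, ?_⟩
      rcases hv with hv | hv
      · grind
      · grind
    · refine ⟨i + 1, x + 1, ⟨?_, x, hx, Or.inr (Or.inr (Or.inr (Or.inr (Or.inr
        ⟨hs, hS, Or.inr ⟨rfl, rfl⟩⟩))))⟩⟩
      refine ⟨by omega, by omega, by omega, by omega, ?_⟩
      grind
  refine ⟨i, x + 2, ⟨?_, x, hx, Or.inr (Or.inr (Or.inr (Or.inl ⟨rfl, rfl, hFT, hFB, by tauto⟩)))⟩⟩
  have e1 : ¬ M.H (i + 1) (x + 2) := fun h => hd ⟨_, Or.inl rfl, h⟩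
  have e2 : ¬ M.H (i - 1) (x + 2) := fun h => hd ⟨_, Or.inr rfl, h⟩
  refine ⟨by omega, by omega, by omega, by omega, ?_⟩
  grind

end Domino

end DomForcing

/-! ### Different trains charge different windows -/

namespace DomForcing
namespace Domino
variable {M : Domino}

/-- No vertical window lies directly above or below `(r, c)`, and no horizontal window directly to
its left or right. -/
def Bare (M : Domino) (r c : ℤ) : Prop :=
  ¬ M.V (r - 1) c ∧ ¬ M.V (r + 1) c ∧ ¬ M.H r (c - 1) ∧ ¬ M.H r (c + 1)

/-- The residues and the neighbours of a charged window tell the rule by which it is charged, and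
the row of the train that charges it. -/
lemma LeftCharge.pattern {sp : Prop} {i r c : ℤ} (h : M.LeftCharge sp i r c) : M.Free r c ∧
    ((c % 3 = 1 ∧ M.H r (c + 1) ∧ M.V i (c - 1) ∧ (r = i + 1 ∨ r = i - 1)) ∨
    (c % 3 = 0 ∧ r % 3 = 2 ∧ ((r = i + 1 ∧ M.V (r - 1) c) ∨ (r = i - 1 ∧ M.V (r + 1) c))) ∨
    (c % 3 = 2 ∧ r = i ∧ M.LEnd i (c - 2)) ∨
    (sp ∧ c % 3 = 0 ∧ r % 3 = 0 ∧ r = i - 2 ∧ (M.V (r + 1) c ∨ M.H r (c + 1))) ∨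
    (sp ∧ c % 3 = 1 ∧ r % 3 = 1 ∧ r = i - 1 ∧ M.Bare r c) ∨
    (sp ∧ c % 3 = 0 ∧ r % 3 = 1 ∧ r = i + 2 ∧ (M.V (r - 1) c ∨ M.H r (c + 1))) ∨
    (sp ∧ c % 3 = 1 ∧ r % 3 = 0 ∧ r = i + 1 ∧ M.Bare r c)) := by
  obtain ⟨hf, x, hx, h⟩ := h
  have hxm := hx.mod
  have hV := hx.V
  refine ⟨hf, ?_⟩
  have hVV := @M.VV
  have hVH := @M.VH
  have hHH := @M.HH
  have hg := @M.H_gap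
  rcases h with ⟨h1, h2, h3⟩ | ⟨h1, h2, h3, h4⟩ | ⟨h1, h2, h3, h4⟩ | ⟨h1, h2, h3, h4, h5⟩ |
      ⟨h1, h2, ⟨h3, h4, h5⟩ | ⟨h3, h4⟩⟩ | ⟨h1, h2, ⟨h3, h4, h5⟩ | ⟨h3, h4⟩⟩
  · left
    subst h1
    refine ⟨by omega, ?_, ?_, h2⟩
    · rwa [show x + 1 + 1 = x + 2 by ring]
    · rwa [show x + 1 - 1 = x by ring]
  · have := h3.1.mod
    subst h1 h2
    refine Or.inr (Or.inl ⟨by omega, by omega, Or.inr ⟨rfl, by rwa [sub_add_cancel]⟩⟩)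
  · have := h3.1.mod
    subst h1 h2
    refine Or.inr (Or.inl ⟨by omega, by omega, Or.inl ⟨rfl, by rwa [add_sub_cancel_right]⟩⟩)
  · subst h1 h2
    refine Or.inr (Or.inr (Or.inl ⟨by omega, rfl, by rwa [add_sub_cancel_right]⟩))
  · have := h2.mod
    subst h3 h4
    refine Or.inr (Or.inr (Or.inr (Or.inl ⟨h1, by omega, by omega, rfl, ?_⟩)))
    rwa [show i - 2 + 1 = i - 1 by ring]
  · have := h2.mod
    have hH := h2.H
    subst h3 h4
    refine Or.inr (Or.inr (Or.inr (Or.inr (Or.inl ⟨h1, by omega, by omega, rfl, ?_⟩))))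
    unfold Bare
    grind
  · have := h2.mod
    subst h3 h4
    refine Or.inr (Or.inr (Or.inr (Or.inr (Or.inr (Or.inl ⟨h1, by omega, by omega, rfl, ?_⟩)))))
    rwa [show i + 2 - 1 = i + 1 by ring]
  · have := h2.mod
    have hH := h2.H
    subst h3 h4
    refine Or.inr (Or.inr (Or.inr (Or.inr (Or.inr (Or.inr ⟨h1, by omega, by omega, rfl, ?_⟩)))))
    unfold Bare
    grind

theorem LeftCharge.injective {sp sp' : Prop} {i i' r c : ℤ} (h : M.LeftCharge sp i r c)
    (h' : M.LeftCharge sp' i' r c) : i = i' := by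
  obtain ⟨⟨-, -, -, -, f1, f2, f3, f4, f5, f6⟩, h⟩ := h.pattern
  obtain ⟨-, h'⟩ := h'.pattern
  have hVV := @M.VV
  have hVH := @M.VH
  have hHH := @M.HH
  have hg := @M.H_gap
  have hg' := @M.V_gap
  rcases h with h | h | h | h | h | h | h <;> rcases h' with h' | h' | h' | h' | h' | h' | h' <;>
    first | omega | skip
  all_goals unfold Bare at *
  all_goals grind

/-- Trains from the left and from the right charge different windows, unless they have the same
target. -/
theorem LeftCharge.ne_flipX {sp sp' : Prop} {i i' r c : ℤ} (h : M.LeftCharge sp i r c)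
    (h' : M.flipX.LeftCharge sp' i' r (M.Q - 1 - c))
    (hj : ∀ x, M.LEnd r x → ¬ M.flipX.LEnd r (M.Q - 1 - (x + 4))) : False := by
  obtain ⟨⟨-, -, -, -, f1, f2, f3, f4, f5, f6⟩, h⟩ := h.pattern
  obtain ⟨-, h'⟩ := h'.pattern
  have hVV := @M.VV
  have hVH := @M.VH
  have hHH := @M.HH
  have hg := @M.H_gap r (c - 1)
  have hg' := @M.V_gap (r - 1) c
  rw [show c - 1 + 2 = c + 1 by ring, sub_add_cancel] at hg
  rw [show r - 1 + 2 = r + 1 by ring, sub_add_cancel] at hg'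
  have hQ := M.hQ
  have eV : ∀ a b, M.flipX.V a b = M.V a (M.Q - 1 - b) := fun _ _ => rfl
  have eH : ∀ a b, M.flipX.H a b = M.H a (M.Q - 1 - b) := fun _ _ => rfl
  have s0 : (M.Q : ℤ) - 1 - (M.Q - 1 - c) = c := by ring
  have s1 : ∀ k : ℤ, (M.Q : ℤ) - 1 - (M.Q - 1 - c - k) = c + k := fun k => by ring
  have s2 : ∀ k : ℤ, (M.Q : ℤ) - 1 - (M.Q - 1 - c + k) = c - k := fun k => by ring
  unfold Bare at h h'
  simp only [eV, eH, s0, s1, s2] at h'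
  rcases h with h | h | h | h | h | h | h <;> rcases h' with h' | h' | h' | h' | h' | h' | h' <;>
    first | omega | skip
  all_goals grind

end Domino

end DomForcing

namespace DomForcing
namespace Domino
variable {M : Domino}

set_option maxHeartbeats 1000000 in
/-- Trains from the left and from the top charge different windows if it is the left ones that give
way. -/
theorem LeftCharge.ne_transpose {i j r c : ℤ} (h : M.LeftCharge True i r c)
    (h' : M.transpose.LeftCharge False j c r) : False := by
  obtain ⟨⟨-, -, -, -, f1, f2, f3, f4, f5, f6⟩, t⟩ := h.pattern
  obtain ⟨-, t'⟩ := h'.pattern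
  obtain ⟨-, x, hx, h⟩ := h
  obtain ⟨-, y, hy, h'⟩ := h'
  have eV : ∀ a b, M.transpose.V a b = M.H b a := fun _ _ => rfl
  have eH : ∀ a b, M.transpose.H a b = M.V b a := fun _ _ => rfl
  have eT : ∀ a b, M.transpose.TEnd a b = M.LEnd a b := fun _ _ => rfl
  have eL : ∀ a b, M.transpose.LEnd a b = M.TEnd a b := fun _ _ => rfl
  simp only [FarTop, FarBottom, SameTop, SameBottom, Bare, eV, eH, eT, eL, false_implies, false_and,
    or_false, and_true, true_implies, true_and] at h h' hy t t'
  have hVx := hx.V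
  have hHy := hy.H
  have hxm := hx.mod
  have hym := hy.mod
  have hVV := @M.VV
  have hVH := @M.VH
  have hHH := @M.HH
  have hg := @M.H_gap r (c - 1)
  have hg' := @M.V_gap (r - 1) c
  rw [show c - 1 + 2 = c + 1 by ring, sub_add_cancel] at hg
  rw [show r - 1 + 2 = r + 1 by ring, sub_add_cancel] at hg'
  have mL : ∀ {a b}, M.LEnd a b → b % 3 = 0 := LEnd.mod
  have mT : ∀ {a b}, M.TEnd a b → b % 3 = 0 := TEnd.mod
  have mB : ∀ {a b}, M.BEnd a b → b % 3 = 1 := BEnd.mod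
  have mB' : ∀ {a b}, M.transpose.BEnd a b → b % 3 = 1 := BEnd.mod
  clear eV eH eT eL t t'
  rcases h with h | h | h | h | h | h <;> rcases h' with h' | h' | h' | h' <;> grind

end Domino

end DomForcing

/-! ### Exceptional trains, and trains from all four sides -/

namespace DomForcing
namespace Domino
variable {M : Domino}

/-- In the column of a top train, vertical windows occur only well below its end. -/
lemma TEnd.le_of_V {i j r : ℤ} (h : M.TEnd j r) (hV : M.V i j) : r + 3 ≤ i := by
  have hr := h.mod
  have h0 := M.V_range hV
  by_contra hc
  by_cases hi : i = r + 2
  · exact M.VH hV h.H (by omega)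
  · have hk : M.H (3 * ((i + 1) / 3)) j := h.2.2.1 _ (by omega) (by omega) (by omega)
    exact M.VH hV hk (by omega)

lemma BEnd.le_of_V {i j r : ℤ} (h : M.BEnd j r) (hV : M.V i j) : i + 3 ≤ r := by
  have h' : M.flipY.TEnd j (M.P - 1 - r) := by rwa [TEnd_flipY, sub_sub_cancel]
  have hV' : M.flipY.V (M.P - 1 - i) j := by
    change M.V (M.P - 1 - (M.P - 1 - i)) j
    rwa [sub_sub_cancel]
  have := h'.le_of_V hV'
  omega

/-- The trains around an exceptional row shield all other rows from being exceptional. -/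
theorem Exceptional.unique {i i' : ℤ} (h : M.Exceptional i) (h' : M.Exceptional i') : i = i' := by
  have aux : ∀ {i i' x x' : ℤ}, M.LEnd i x → M.LEnd i' x' →
      ((M.FarBottom i x ∧ M.TEnd x (i - 3)) ∨ (M.FarTop i x ∧ M.BEnd x (i + 3))) →
      x < x' → False := by
    intro i i' x x' hx hx' h hlt
    have hm := hx.mod
    have hm' := hx'.mod
    have h0 := hx.1
    have v0 : M.V i' x := hx'.2.2.1 x h0 (by omega) hm
    have v3 : M.V i' (x + 3) := hx'.2.2.1 (x + 3) (by omega) (by omega) (by omega)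
    rcases h with ⟨⟨h1, -⟩, h2⟩ | ⟨⟨h1, -⟩, h2⟩
    · have := h1.le_of_V v3
      have := h2.le_of_V v0
      omega
    · have := h1.le_of_V v3
      have := h2.le_of_V v0
      omega
  have aux2 : ∀ {i i' x : ℤ}, M.LEnd i x → M.LEnd i' x →
      (M.FarBottom i x ∧ M.TEnd x (i - 3)) → (M.FarTop i' x ∧ M.BEnd x (i' + 3)) → False := by
    rintro i i' x hx hx' ⟨⟨h1, h2⟩, h3⟩ ⟨⟨h4, h5⟩, h6⟩
    have a1 := h3.le_of_V hx'.V
    have a2 := h3.mod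
    have a3 := h4.mod
    have hH : M.H i (x + 3) := h4.2.2.1 i (M.V_range hx.V).1 (by omega) (by omega)
    exact M.VH h2 hH (by omega)
  obtain ⟨x, hx, h⟩ := h
  obtain ⟨x', hx', h'⟩ := h'
  rcases lt_trichotomy x x' with hlt | rfl | hlt
  · exact (aux hx hx' h hlt).elim
  · rcases h with h | h <;> rcases h' with h' | h'
    · have := h.2.le_of_V hx'.V
      have := h'.2.le_of_V hx.V
      omega
    · exact (aux2 hx hx' h h').elim
    · exact (aux2 hx' hx h' h).elim
    · have := h.2.le_of_V hx'.V
      have := h'.2.le_of_V hx.V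
      omega
  · exact (aux hx' hx h' hlt).elim

variable (M)

/-- The left and the right train of row `i` have the same target: their ends are four columns
apart. -/
def Jog (i : ℤ) : Prop := ∃ x, M.LEnd i x ∧ M.flipX.LEnd i (M.Q - 1 - (x + 4))

/-- The train that starts at position `i` of the side `k` charges the window `(r, c)`. The sides are
numbered left, right, top, bottom; trains from the left and the right give way to the other ones. -/
def Charge (k : Fin 4) (i r c : ℤ) : Prop :=
  match k with
  | 0 => M.LeftCharge True i r c
  | 1 => M.flipX.LeftCharge True i r (M.Q - 1 - c)
  | 2 => M.transpose.LeftCharge False i c r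
  | 3 => M.flipY.transpose.LeftCharge False i c (M.P - 1 - r)

variable {M}

theorem Charge.free {k : Fin 4} {i r c : ℤ} (h : M.Charge k i r c) : M.Free r c := by
  fin_cases k
  · exact h.1
  · obtain ⟨h1, h2, h3, h4, h5, h6, h7, h8, h9, h10⟩ := h.1
    change ¬ M.V r (M.Q - 1 - (M.Q - 1 - c)) at h5
    change ¬ M.H r (M.Q - 1 - (M.Q - 1 - c)) at h6
    change ¬ M.V r (M.Q - 1 - (M.Q - 1 - c - 1)) at h7
    change ¬ M.V r (M.Q - 1 - (M.Q - 1 - c + 1)) at h8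
    change ¬ M.H (r - 1) (M.Q - 1 - (M.Q - 1 - c)) at h9
    change ¬ M.H (r + 1) (M.Q - 1 - (M.Q - 1 - c)) at h10
    change r < M.P at h2
    change M.Q - 1 - c < M.Q at h4
    rw [sub_sub_cancel] at h5 h6 h9 h10
    rw [show (M.Q : ℤ) - 1 - (M.Q - 1 - c - 1) = c + 1 by ring] at h7
    rw [show (M.Q : ℤ) - 1 - (M.Q - 1 - c + 1) = c - 1 by ring] at h8
    exact ⟨h1, h2, by omega, by omega, h5, h6, h8, h7, h9, h10⟩
  · obtain ⟨h1, h2, h3, h4, h5, h6, h7, h8, h9, h10⟩ := h.1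
    exact ⟨h3, h4, h1, h2, h6, h5, h9, h10, h7, h8⟩
  · obtain ⟨h1, h2, h3, h4, h5, h6, h7, h8, h9, h10⟩ := h.1
    change ¬ M.H (M.P - 1 - (M.P - 1 - r)) c at h5
    change ¬ M.V (M.P - 1 - (M.P - 1 - r)) c at h6
    change ¬ M.H (M.P - 1 - (M.P - 1 - r - 1)) c at h7
    change ¬ M.H (M.P - 1 - (M.P - 1 - r + 1)) c at h8
    change ¬ M.V (M.P - 1 - (M.P - 1 - r)) (c - 1) at h9
    change ¬ M.V (M.P - 1 - (M.P - 1 - r)) (c + 1) at h10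
    change c < M.Q at h2
    change M.P - 1 - r < M.P at h4
    rw [sub_sub_cancel] at h5 h6 h9 h10
    rw [show (M.P : ℤ) - 1 - (M.P - 1 - r - 1) = r + 1 by ring] at h7
    rw [show (M.P : ℤ) - 1 - (M.P - 1 - r + 1) = r - 1 by ring] at h8
    exact ⟨by omega, by omega, h1, h2, h6, h5, h9, h10, h8, h7⟩

/-- Trains from different sides charge different windows. By the reflections of the board there are
only two cases, opposite sides and adjacent sides. -/
theorem Charge.ne (hrow : ∀ i, ¬ M.Jog i) (hcol : ∀ j, ¬ M.transpose.Jog j) {k l : Fin 4}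
    (hkl : k < l) {i j r c : ℤ} (h : M.Charge k i r c) (h' : M.Charge l j r c) : False := by
  fin_cases k <;> fin_cases l <;> try exact absurd hkl (by decide)
  · exact LeftCharge.ne_flipX h h' fun x hx hx' => hrow r ⟨x, hx, hx'⟩
  · exact LeftCharge.ne_transpose h h'
  · exact LeftCharge.ne_transpose (M := M.flipY) (LeftCharge.flipY h) h'
  · exact LeftCharge.ne_transpose (M := M.flipX) h (LeftCharge.flipY (M := M.transpose) h')
  · refine LeftCharge.ne_transpose (M := M.flipY.flipX) (LeftCharge.flipY (M := M.flipX) h)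
      (LeftCharge.flipY (M := M.flipY.transpose) h')
  · exact LeftCharge.ne_flipX (M := M.transpose) h h' fun x hx hx' => hcol c ⟨x, hx, hx'⟩

theorem Charge.injective {k : Fin 4} {i j r c : ℤ} (h : M.Charge k i r c)
    (h' : M.Charge k j r c) : i = j := by
  fin_cases k
  · exact LeftCharge.injective h h'
  · exact LeftCharge.injective (M := M.flipX) h h'
  · exact LeftCharge.injective (M := M.transpose) h h'
  · exact LeftCharge.injective (M := M.flipY.transpose) h h'

end Domino

end DomForcing

/-! ### Counting the free windows -/

namespace DomForcing
open Finset
namespace Domino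
variable (M : Domino)

/-- The reflections of the board that move the left, right, top and bottom side to the left. -/
def side (k : Fin 4) : Domino :=
  match k with
  | 0 => M
  | 1 => M.flipX
  | 2 => M.transpose
  | 3 => M.flipY.transpose

variable {M}

theorem exists_charge {k : Fin 4} {i : ℤ} (h : (M.side k).V i 0)
    (he : ¬ (M.side k).Exceptional i) : ∃ r c, M.Charge k i r c := by
  fin_cases k
  · exact exists_leftCharge True h he
  · obtain ⟨r, c, h⟩ := exists_leftCharge True h he
    refine ⟨r, M.Q - 1 - c, ?_⟩
    change M.flipX.LeftCharge True i r (M.Q - 1 - (M.Q - 1 - c))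
    rwa [sub_sub_cancel]
  · obtain ⟨r, c, h⟩ := exists_leftCharge False h he
    exact ⟨c, r, h⟩
  · obtain ⟨r, c, h⟩ := exists_leftCharge False h he
    refine ⟨M.P - 1 - c, r, ?_⟩
    change M.flipY.transpose.LeftCharge False i r (M.P - 1 - (M.P - 1 - c))
    rwa [sub_sub_cancel]

lemma sum_ind_eq_card {ι : Type*} (s : Finset ι) (a : ι → Prop) [DecidablePred a] :
    ∑ i ∈ s, ind (a i) = #{i ∈ s | a i} := by
  simp only [ind]
  rw [Finset.card_filter]
  push_cast
  refine sum_congr rfl fun i _ => ?_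
  split_ifs <;> rfl

/-- All trains except for at most one exceptional train per side have a free window of their own. -/
theorem sum_side_le (hrow : ∀ i, ¬ M.Jog i) (hcol : ∀ j, ¬ M.transpose.Jog j) :
    ∑ k : Fin 4, ∑ i ∈ Finset.range (M.side k).P, ind ((M.side k).V i 0)
      ≤ ∑ r ∈ Finset.range M.P, ∑ c ∈ Finset.range M.Q, ind (M.Free r c) + 4 := by
  classical
  let s : Finset (Σ _ : Fin 4, ℕ) := univ.sigma fun k =>
    {i ∈ Finset.range (M.side k).P |
      (M.side k).V ((i : ℕ) : ℤ) 0 ∧ ¬ (M.side k).Exceptional ((i : ℕ) : ℤ)}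
  let t : Finset (ℕ × ℕ) :=
    {a ∈ Finset.range M.P ×ˢ Finset.range M.Q | M.Free (a.1 : ℤ) (a.2 : ℤ)}
  have hst : #s ≤ #t := by
    refine card_le_card_of_forall_subsingleton
      (fun a b => M.Charge a.1 ((a.2 : ℕ) : ℤ) ((b.1 : ℕ) : ℤ) ((b.2 : ℕ) : ℤ)) ?_ ?_
    · rintro ⟨k, i⟩ hk
      simp only [s, mem_sigma, mem_univ, mem_filter, true_and] at hk
      obtain ⟨r, c, h⟩ := exists_charge hk.2.1 hk.2.2
      have hf := h.free
      obtain ⟨h1, h2, h3, h4, -⟩ := id hf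
      lift r to ℕ using h1
      lift c to ℕ using h3
      refine ⟨(r, c), ?_, h⟩
      simp only [t, mem_filter, mem_product, mem_range]
      exact ⟨⟨by omega, by omega⟩, hf⟩
    · rintro ⟨r, c⟩ - ⟨k, i⟩ ⟨-, h⟩ ⟨l, j⟩ ⟨-, h'⟩
      dsimp only at h h'
      rcases lt_trichotomy k l with hkl | rfl | hkl
      · exact (Charge.ne hrow hcol hkl h h').elim
      · have := Charge.injective h h'
        obtain rfl : i = j := by omega
        rfl
      · exact (Charge.ne hrow hcol hkl h' h).elim
  have ht : ∑ r ∈ Finset.range M.P, ∑ c ∈ Finset.range M.Q, ind (M.Free r c) = #t := by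
    rw [← sum_product', ← sum_ind_eq_card]
  have hs : ∑ k : Fin 4, ∑ i ∈ Finset.range (M.side k).P, ind ((M.side k).V i 0) ≤ #s + 4 := by
    have h4 : ∑ k : Fin 4, (1 : ℤ) = 4 := by simp
    rw [card_sigma, ← h4]
    push_cast
    rw [← sum_add_distrib]
    refine sum_le_sum fun k _ => ?_
    rw [sum_ind_eq_card]
    have h1 : #{i ∈ Finset.range (M.side k).P | (M.side k).Exceptional ((i : ℕ) : ℤ)} ≤ 1 := by
      rw [card_le_one]
      intro a ha b hb
      have := Exceptional.unique (mem_filter.1 ha).2 (mem_filter.1 hb).2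
      omega
    have h2 : {i ∈ Finset.range (M.side k).P | (M.side k).V ((i : ℕ) : ℤ) 0} ⊆
        {i ∈ Finset.range (M.side k).P | (M.side k).V ((i : ℕ) : ℤ) 0 ∧
          ¬ (M.side k).Exceptional ((i : ℕ) : ℤ)} ∪
        {i ∈ Finset.range (M.side k).P | (M.side k).Exceptional ((i : ℕ) : ℤ)} := by
      intro i
      simp only [mem_union, mem_filter]
      tauto
    have h3 := (card_le_card h2).trans (card_union_le _ _)
    exact_mod_cast h3.trans (by omega)
  rw [ht]
  have : (#s : ℤ) ≤ #t := by exact_mod_cast hst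
  linarith

lemma sum_range_sub_one (f : ℤ → ℤ) (n : ℕ) :
    ∑ i ∈ Finset.range n, f (i - 1) = ∑ i ∈ Finset.range n, f i + f (-1) - f (n - 1) := by
  induction n with
  | zero => simp
  | succ n ih =>
    rw [sum_range_succ, sum_range_succ, ih]
    push_cast
    rw [add_sub_cancel_right]
    ring

lemma sum_range_add_one (f : ℤ → ℤ) (n : ℕ) :
    ∑ i ∈ Finset.range n, f (i + 1) = ∑ i ∈ Finset.range n, f i - f 0 + f n := by
  induction n with
  | zero => simp
  | succ n ih =>
    rw [sum_range_succ, sum_range_succ, ih]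
    push_cast
    ring

variable (M) in
/-- At most one of the reasons for a window not to be free applies. -/
lemma ind_free (r c : ℤ) :
    ind (M.Free r c) ≤ 1 - ind (M.V r c) - ind (M.H r c) - ind (M.V r (c - 1)) - ind (M.V r (c + 1))
      - ind (M.H (r - 1) c) - ind (M.H (r + 1) c) := by
  by_cases hf : M.Free r c
  · obtain ⟨-, -, -, -, h1, h2, h3, h4, h5, h6⟩ := id hf
    simp [ind_pos hf, ind_neg h1, ind_neg h2, ind_neg h3, ind_neg h4, ind_neg h5, ind_neg h6]
  have hex : ∀ {a b : Prop}, (a → b → False) → ind a + ind b ≤ 1 := by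
    intro a b h
    simp only [ind]
    split_ifs <;> simp_all
  rw [ind_neg hf]
  have p1 := hex fun (h : M.V r c) (h' : M.H r c) => M.VH h h' (by omega)
  have p2 := hex fun (h : M.V r (c - 1)) (h' : M.V r c) => M.VV h h' (by omega)
  have p3 := hex fun (h : M.V r c) (h' : M.V r (c + 1)) => M.VV h h' (by omega)
  have p4 := hex fun (h : M.V r c) (h' : M.H (r - 1) c) => M.VH h h' (by omega)
  have p5 := hex fun (h : M.V r c) (h' : M.H (r + 1) c) => M.VH h h' (by omega)
  have p6 := hex fun (h : M.V r (c - 1)) (h' : M.H r c) => M.VH h h' (by omega)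
  have p7 := hex fun (h : M.V r (c + 1)) (h' : M.H r c) => M.VH h h' (by omega)
  have p8 := hex fun (h : M.H (r - 1) c) (h' : M.H r c) => M.HH h h' (by omega)
  have p9 := hex fun (h : M.H r c) (h' : M.H (r + 1) c) => M.HH h h' (by omega)
  have p10 := hex fun (h : M.V r (c - 1)) (h' : M.V r (c + 1)) => M.VV h h' (by omega)
  have p11 := hex fun (h : M.V r (c - 1)) (h' : M.H (r - 1) c) => M.VH h h' (by omega)
  have p12 := hex fun (h : M.V r (c - 1)) (h' : M.H (r + 1) c) => M.VH h h' (by omega)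
  have p13 := hex fun (h : M.V r (c + 1)) (h' : M.H (r - 1) c) => M.VH h h' (by omega)
  have p14 := hex fun (h : M.V r (c + 1)) (h' : M.H (r + 1) c) => M.VH h h' (by omega)
  have p15 := hex fun (h : M.H (r - 1) c) (h' : M.H (r + 1) c) => M.HH h h' (by omega)
  have q1 := ind_nonneg (M.V r c)
  have q2 := ind_nonneg (M.H r c)
  have q3 := ind_nonneg (M.V r (c - 1))
  have q4 := ind_nonneg (M.V r (c + 1))
  have q5 := ind_nonneg (M.H (r - 1) c)
  have q6 := ind_nonneg (M.H (r + 1) c)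
  omega

variable (M) in
/-- The windows are counted by type: besides the empty ones there are the free ones and two
neighbours for each empty window, up to those that stick out of the board. -/
theorem sum_free_le :
    ∑ r ∈ Finset.range M.P, ∑ c ∈ Finset.range M.Q, ind (M.Free r c) ≤
      ∑ r ∈ Finset.range M.P, ∑ c ∈ Finset.range M.Q, (1 - 3 * (ind (M.V r c) + ind (M.H r c))) +
      ∑ k : Fin 4, ∑ i ∈ Finset.range (M.side k).P, ind ((M.side k).V i 0) := by
  have h1 : ∑ r ∈ Finset.range M.P, ∑ c ∈ Finset.range M.Q, ind (M.Free r c) ≤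
      ∑ r ∈ Finset.range M.P, ∑ c ∈ Finset.range M.Q,
      (1 - ind (M.V r c) - ind (M.H r c) - ind (M.V r (c - 1)) - ind (M.V r (c + 1))
      - ind (M.H (r - 1) c) - ind (M.H (r + 1) c)) := by
    exact sum_le_sum fun r _ => sum_le_sum fun c _ => M.ind_free r c
  refine h1.trans (le_of_eq ?_)
  have zV : ∀ r c : ℤ, (c < 0 ∨ M.Q ≤ c) → ind (M.V r c) = 0 := fun r c h =>
    ind_neg fun h' => by have := M.V_range h'; omega
  have zH : ∀ r c : ℤ, (r < 0 ∨ M.P ≤ r) → ind (M.H r c) = 0 := fun r c h =>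
    ind_neg fun h' => by have := M.H_range h'; omega
  have a1 : ∀ r : ℤ, ∑ c ∈ Finset.range M.Q, ind (M.V r (c - 1)) =
      ∑ c ∈ Finset.range M.Q, ind (M.V r c) - ind (M.V r (M.Q - 1)) := fun r => by
    rw [sum_range_sub_one (fun c => ind (M.V r c)), zV r (-1) (by omega)]
    ring
  have a2 : ∀ r : ℤ, ∑ c ∈ Finset.range M.Q, ind (M.V r (c + 1)) =
      ∑ c ∈ Finset.range M.Q, ind (M.V r c) - ind (M.V r 0) := fun r => by
    rw [sum_range_add_one (fun c => ind (M.V r c)), zV r M.Q (by omega)]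
    ring
  have a3 : ∀ c : ℤ, ∑ r ∈ Finset.range M.P, ind (M.H (r - 1) c) =
      ∑ r ∈ Finset.range M.P, ind (M.H r c) - ind (M.H (M.P - 1) c) := fun c => by
    rw [sum_range_sub_one (fun r => ind (M.H r c)), zH (-1) c (by omega)]
    ring
  have a4 : ∀ c : ℤ, ∑ r ∈ Finset.range M.P, ind (M.H (r + 1) c) =
      ∑ r ∈ Finset.range M.P, ind (M.H r c) - ind (M.H 0 c) := fun c => by
    rw [sum_range_add_one (fun r => ind (M.H r c)), zH M.P c (by omega)]
    ring
  have b3 : ∑ r ∈ Finset.range M.P, ∑ c ∈ Finset.range M.Q, ind (M.H (r - 1) c) =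
      ∑ r ∈ Finset.range M.P, ∑ c ∈ Finset.range M.Q, ind (M.H r c)
        - ∑ c ∈ Finset.range M.Q, ind (M.H (M.P - 1) c) := by
    rw [sum_comm]
    simp only [a3, sum_sub_distrib]
    rw [sum_comm]
  have b4 : ∑ r ∈ Finset.range M.P, ∑ c ∈ Finset.range M.Q, ind (M.H (r + 1) c) =
      ∑ r ∈ Finset.range M.P, ∑ c ∈ Finset.range M.Q, ind (M.H r c)
        - ∑ c ∈ Finset.range M.Q, ind (M.H 0 c) := by
    rw [sum_comm]
    simp only [a4, sum_sub_distrib]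
    rw [sum_comm]
  have c0 : ∑ i ∈ Finset.range (M.side 0).P, ind ((M.side 0).V i 0)
      = ∑ i ∈ Finset.range M.P, ind (M.V i 0) := rfl
  have c1 : ∑ i ∈ Finset.range (M.side 1).P, ind ((M.side 1).V i 0)
      = ∑ i ∈ Finset.range M.P, ind (M.V i (M.Q - 1)) := by
    change ∑ i ∈ Finset.range M.P, ind (M.V i (M.Q - 1 - 0)) = _
    simp only [sub_zero]
  have c2 : ∑ i ∈ Finset.range (M.side 2).P, ind ((M.side 2).V i 0)
      = ∑ i ∈ Finset.range M.Q, ind (M.H 0 i) := rfl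
  have c3 : ∑ i ∈ Finset.range (M.side 3).P, ind ((M.side 3).V i 0)
      = ∑ i ∈ Finset.range M.Q, ind (M.H (M.P - 1) i) := by
    change ∑ i ∈ Finset.range M.Q, ind (M.H (M.P - 1 - 0) i) = _
    simp only [sub_zero]
  rw [Fin.sum_univ_four, c0, c1, c2, c3]
  simp only [sum_sub_distrib, mul_add, sum_add_distrib, ← mul_sum, b3, b4, a1, a2]
  ring

theorem neg_four_le (hrow : ∀ i, ¬ M.Jog i) (hcol : ∀ j, ¬ M.transpose.Jog j) :
    -4 ≤ ∑ r ∈ Finset.range M.P, ∑ c ∈ Finset.range M.Q,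
      (1 - 3 * (ind (M.V r c) + ind (M.H r c))) := by
  have h1 := sum_side_le hrow hcol
  have h2 := M.sum_free_le
  linarith

end Domino

end DomForcing

/-! ### The total excess when both side lengths are `2` modulo `3` -/

namespace DomForcing
open Finset
namespace Board

/-- The empty windows of a board, sorted by whether they have a horizontal empty neighbour. -/
def toDomino (M : Board) (hP : M.P % 3 = 2) (hQ : M.Q % 3 = 2) : Domino where
  P := M.P
  Q := M.Q
  hP := hP
  hQ := hQ
  V i x := M.E i x ∧ ¬ M.E i (x - 1) ∧ ¬ M.E i (x + 1)
  H i x := M.E i x ∧ (M.E i (x - 1) ∨ M.E i (x + 1))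
  V_range h := M.range h.1
  H_range h := M.range h.1
  VV := by
    rintro i x j y ⟨h, h1, h2⟩ ⟨h', h1', h2'⟩ (⟨rfl, rfl | rfl⟩ | ⟨rfl, rfl | rfl⟩)
    · exact h2 h'
    · exact h2 (M.gap_h h h')
    · exact M.diag h h'
    · exact M.diag' (x := x - 1) (by rwa [sub_add_cancel]) h'
  HH := by
    have key : ∀ {i x}, M.E i x → M.E i (x - 1) ∨ M.E i (x + 1) → ¬ M.E (i + 1) x := by
      rintro i x h (h' | h') k
      · exact M.diag h' (by rwa [sub_add_cancel])
      · exact M.diag' h' k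
    rintro i x j y ⟨h, h1⟩ ⟨h', h1'⟩ (⟨rfl, rfl | rfl⟩ | ⟨rfl, rfl | rfl⟩)
    · exact key h h1 h'
    · exact key h h1 (M.gap_v h h')
    · exact M.diag h h'
    · exact M.diag' (x := x - 1) (by rwa [sub_add_cancel]) h'
  VH := by
    have d : ∀ {i j x y}, M.E i x → M.E j y → j - i = 1 ∨ i - j = 1 → y - x = 1 ∨ x - y = 1 →
        False := by
      intro i j x y h h' a b
      rcases a with a | a <;> rcases b with b | b
      · obtain rfl : j = i + 1 := by omega
        obtain rfl : y = x + 1 := by omega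
        exact M.diag h h'
      · obtain rfl : j = i + 1 := by omega
        obtain rfl : x = y + 1 := by omega
        exact M.diag' h h'
      · obtain rfl : i = j + 1 := by omega
        obtain rfl : y = x + 1 := by omega
        exact M.diag' h' h
      · obtain rfl : i = j + 1 := by omega
        obtain rfl : x = y + 1 := by omega
        exact M.diag h' h
    -- a vertical neighbour of a horizontal pair
    have key : ∀ {i j y}, M.E i y → M.E j (y - 1) ∨ M.E j (y + 1) → j - i = 1 ∨ i - j = 1 →
        False := by
      rintro i j y h (h' | h') a
      · exact d h h' a (by omega)
      · exact d h h' a (by omega)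
    rintro i x j y ⟨h, h1, h2⟩ ⟨h', h'1⟩ k
    by_cases hj : j = i
    · subst hj
      rcases (by omega : y = x ∨ y = x + 1 ∨ y = x - 1 ∨ y = x + 2 ∨ x = y + 2) with
        rfl | rfl | rfl | rfl | rfl
      · tauto
      · exact h2 h'
      · exact h1 h'
      · exact h2 (M.gap_h h h')
      · exact h1 (by rw [show y + 2 - 1 = y + 1 by ring]; exact M.gap_h h' h)
    by_cases hy : y = x
    · subst hy
      rcases (by omega : j = i + 1 ∨ i = j + 1 ∨ j = i + 2 ∨ i = j + 2) with
        rfl | rfl | rfl | rfl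
      · exact key h h'1 (by omega)
      · exact key h h'1 (by omega)
      · exact key (M.gap_v h h') h'1 (by omega)
      · exact key (M.gap_v h' h) h'1 (by omega)
    · exact d h h' (by omega) (by omega)
  V_gap := by
    rintro i x ⟨h, h1, h2⟩ ⟨h', h1', h2'⟩
    exact ⟨M.gap_v h h', fun k => M.diag' (x := x - 1) (by rwa [sub_add_cancel]) k,
      fun k => M.diag h k⟩
  H_gap := by
    rintro i x ⟨h, h1⟩ ⟨h', h1'⟩
    exact ⟨M.gap_h h h', Or.inl (by rwa [add_sub_cancel_right])⟩
  V_left h := h.2.1 (M.left h.1)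
  V_right h := h.2.2 (by
    rw [show (M.Q : ℤ) - 2 + 1 = M.Q - 1 by ring]
    exact M.right h.1)
  H_top {x} h := by
    have h0 := M.top h.1
    rcases h.2 with h' | h'
    · exact M.diag' (x := x - 1) (i := 0) (by rwa [sub_add_cancel]) h'
    · exact M.diag h0 h'
  H_bottom {x} h := by
    have h0 := M.bottom h.1
    rw [show (M.P : ℤ) - 1 = M.P - 2 + 1 by ring] at h0
    rcases h.2 with h' | h'
    · exact M.diag h' (by rwa [sub_add_cancel])
    · exact M.diag' h' h0

variable (M : Board)

lemma ind_E_eq_toDomino (hP : M.P % 3 = 2) (hQ : M.Q % 3 = 2) (i x : ℤ) :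
    ind (M.E i x) = ind ((M.toDomino hP hQ).V i x) + ind ((M.toDomino hP hQ).H i x) := by
  simp only [toDomino, ind]
  split_ifs <;> grind

lemma total_eq : M.total = ∑ r ∈ Finset.range M.P, ∑ c ∈ Finset.range M.Q, M.val r c := by
  rw [total_eq_sum_row]
  rfl

/-- The vertical windows of row `i` sit in all positions congruent `0` modulo `3` up to `x`, and
all positions congruent `1` modulo `3` from `x + 4` on. -/
def JogAt (i x : ℤ) : Prop := 0 ≤ x ∧ x < M.Q ∧ x % 3 = 0 ∧
  (∀ k, 0 ≤ k → k ≤ x → k % 3 = 0 → M.E i k ∧ ¬ M.E i (k - 1) ∧ ¬ M.E i (k + 1)) ∧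
  (∀ k, x + 4 ≤ k → k < M.Q → k % 3 = 1 → M.E i k ∧ ¬ M.E i (k - 1) ∧ ¬ M.E i (k + 1))

/-- Here `N` is the domino of `M`, or of its reflection, with one type of empty windows as `V`. -/
lemma jogAt_of_jog (N : Domino) (hNQ : N.Q = M.Q)
    (hV : ∀ i x, N.V i x → M.E i x ∧ ¬ M.E i (x - 1) ∧ ¬ M.E i (x + 1)) {i : ℤ}
    (h : N.Jog i) : ∃ x, M.JogAt i x := by
  obtain ⟨x, h, h'⟩ := h
  have hQ := N.hQ
  refine ⟨x, h.1, by rw [← hNQ]; exact (N.V_range h.V).2.2.2, h.2.1,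
    fun k a b c => hV _ _ (h.2.2.1 k a b c), fun k hk hk' hk3 => hV _ _ ?_⟩
  have h1 := h'.2.2.1 (N.Q - 1 - k) (by omega) (by omega) (by omega)
  change N.V i (N.Q - 1 - (N.Q - 1 - k)) at h1
  rwa [sub_sub_cancel] at h1

/-- In a row without two adjacent empty windows, each three consecutive windows contain at most one
empty window. -/
lemma neg_one_le_row (hQ : M.Q % 3 = 2) (i : ℤ)
    (h : ∀ y : ℤ, 0 ≤ y → y + 1 < M.Q → ¬ (M.E i y ∧ M.E i (y + 1))) : -1 ≤ M.row i := by
  have h' : ∀ y, ¬ (M.E i y ∧ M.E i (y + 1)) := fun y hy => by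
    have := M.range hy.1
    have := M.range hy.2
    exact h y (by omega) (by omega) hy
  have h3 : ∀ y, ind (M.E i y) + ind (M.E i (y + 1)) + ind (M.E i (y + 2)) ≤ 1 := by
    intro y
    by_contra hc
    have := M.middle_of_two_le (i := i) (y := y) (by omega)
    have h1 := h' y
    have h2 := h' (y + 1)
    rw [add_assoc] at h2
    norm_num at h2
    tauto
  have key : ∀ k : ℕ, ∑ x ∈ Finset.range (3 * k), ind (M.E i x) ≤ k := by
    intro k
    induction k with
    | zero => simp
    | succ k ih =>
      rw [show 3 * (k + 1) = 3 * k + 1 + 1 + 1 by ring, sum_range_succ, sum_range_succ,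
        sum_range_succ]
      have := h3 (3 * k : ℕ)
      push_cast at this ih ⊢
      simp only [add_assoc] at this ⊢
      linarith
  have hk := key (M.Q / 3 + 1)
  rw [show 3 * (M.Q / 3 + 1) = M.Q + 1 by omega, sum_range_succ] at hk
  have h0 := ind_nonneg (M.E i M.Q)
  have hz : 0 ≤ ∑ x ∈ Finset.range M.Q, ind (M.Z i x) := sum_nonneg fun _ _ => ind_nonneg _
  have : M.row i = M.Q - 3 * ∑ x ∈ Finset.range M.Q, ind (M.E i x)
      + 3 * ∑ x ∈ Finset.range M.Q, ind (M.Z i x) := by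
    simp [row, val, sum_add_distrib, sum_sub_distrib, mul_sum]
  omega

variable {M}

/-- Of any two adjacent windows in the row of a jog, at least one is a horizontal neighbour of a
vertical empty window `p` of that row. -/
lemma JogAt.near {i x : ℤ} (hQ : M.Q % 3 = 2) (h : M.JogAt i x) {y : ℤ} (hy : 0 ≤ y)
    (hy' : y + 1 < M.Q) : ∃ p, M.E i p ∧ ¬ M.E i (p - 1) ∧ ¬ M.E i (p + 1) ∧
      (y = p + 1 ∨ y = p - 1 ∨ y + 1 = p + 1 ∨ y + 1 = p - 1) := by
  obtain ⟨h0, h1, h2, h3, h4⟩ := h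
  rcases (by omega : y % 3 = 0 ∨ y % 3 = 1 ∨ y % 3 = 2) with m | m | m
  · by_cases hx : y ≤ x
    · obtain ⟨a, b, c⟩ := h3 y hy hx m
      exact ⟨y, a, b, c, by omega⟩
    · obtain ⟨a, b, c⟩ := h4 (y + 1) (by omega) (by omega) (by omega)
      exact ⟨y + 1, a, b, c, by omega⟩
  · by_cases hx : y - 1 ≤ x
    · obtain ⟨a, b, c⟩ := h3 (y - 1) (by omega) hx (by omega)
      exact ⟨y - 1, a, b, c, by omega⟩
    · obtain ⟨a, b, c⟩ := h4 y (by omega) (by omega) (by omega)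
      exact ⟨y, a, b, c, by omega⟩
  · by_cases hx : y + 1 ≤ x
    · obtain ⟨a, b, c⟩ := h3 (y + 1) (by omega) hx (by omega)
      exact ⟨y + 1, a, b, c, by omega⟩
    · obtain ⟨a, b, c⟩ := h4 (y + 2) (by omega) (by omega) (by omega)
      exact ⟨y + 2, a, b, c, by omega⟩

lemma JogAt.row_ge {i x : ℤ} (hQ : M.Q % 3 = 2) (h : M.JogAt i x) {j : ℤ}
    (hj : j = i ∨ j = i + 1 ∨ j = i - 1) : -1 ≤ M.row j := by
  refine M.neg_one_le_row hQ j fun y hy hy' ⟨a, b⟩ => ?_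
  obtain ⟨p, hp, hp1, hp2, hyp⟩ := h.near hQ hy hy'
  have c : M.E j (p + 1) ∨ M.E j (p - 1) := by
    rcases hyp with h | h | h | h
    · exact Or.inl (h ▸ a)
    · exact Or.inr (h ▸ a)
    · exact Or.inl (h ▸ b)
    · exact Or.inr (h ▸ b)
  rcases hj with rfl | rfl | rfl
  · tauto
  · rcases c with c | c
    · exact M.diag hp c
    · exact M.diag' (x := p - 1) (by rwa [sub_add_cancel]) c
  · obtain ⟨k, rfl⟩ : ∃ k, i = k + 1 := ⟨i - 1, by ring⟩
    rw [add_sub_cancel_right] at c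
    rcases c with c | c
    · exact M.diag' c hp
    · exact M.diag c (by rwa [sub_add_cancel])

/-- Each three consecutive columns contain an empty window of the row of a jog. -/
lemma JogAt.sum_ge {i x : ℤ} (hQ : M.Q % 3 = 2) (h : M.JogAt i x) :
    (M.Q : ℤ) + 1 ≤ 3 * ∑ y ∈ Finset.range M.Q, ind (M.E i y) := by
  have key : ∀ k : ℕ, 3 * k ≤ M.Q + 1 → (k : ℤ) ≤ ∑ x ∈ Finset.range (3 * k), ind (M.E i x) := by
    intro k
    induction k with
    | zero => simp
    | succ k ih =>
      intro hk
      have ih := ih (by omega)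
      rw [show 3 * (k + 1) = 3 * k + 1 + 1 + 1 by ring, sum_range_succ, sum_range_succ,
        sum_range_succ]
      have n0 := ind_nonneg (M.E i (3 * k : ℕ))
      have n1 := ind_nonneg (M.E i (3 * k + 1 : ℕ))
      have n2 := ind_nonneg (M.E i (3 * k + 2 : ℕ))
      have : ind (M.E i (3 * k : ℕ)) = 1 ∨ ind (M.E i (3 * k + 1 : ℕ)) = 1 := by
        simp only [ind_eq_one]
        by_cases hx : ((3 * k : ℕ) : ℤ) ≤ x
        · exact Or.inl (h.2.2.2.1 _ (by omega) hx (by omega)).1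
        · have := h.2.2.1
          exact Or.inr (h.2.2.2.2 _ (by omega) (by omega) (by omega)).1
      omega
  have hk := key (M.Q / 3 + 1) (by omega)
  rw [show 3 * (M.Q / 3 + 1) = M.Q + 1 by omega, sum_range_succ,
    ind_neg (fun h => by have := M.range h; omega)] at hk
  omega

/-- If a row contains two opposite trains with the same target, the rows are split into triples and
two remaining rows. In that row and its neighbours there are no two adjacent empty windows, so the
two remaining rows are chosen among these if possible. If the number `i` of the row is `2` modulo
`3`, the remaining rows are the next two, and the many empty windows of row `i` limit those of the
next two rows. -/
theorem JogAt.total_ge {i x : ℤ} (hP : M.P % 3 = 2) (hQ : M.Q % 3 = 2) (h : M.JogAt i x) :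
    -2 ≤ M.total := by
  have hi := M.range (h.2.2.2.1 0 le_rfl h.1 rfl).1
  have hQ1 : M.transpose.P % 3 = 1 → ∀ y, ¬ M.transpose.PerfectCol y := fun h => by
    change M.Q % 3 = 1 at h
    omega
  have hQ2 : 2 ≤ M.transpose.P := by change 2 ≤ M.Q; omega
  have split : ∀ j : ℤ, 0 ≤ j → j % 3 = 0 → j < M.P → M.row j + M.row (j + 1) ≤ M.total := by
    intro j hj hj3 hjP
    lift j to ℕ using hj
    have := M.transpose.total_ge hQ2 hQ1 (j / 3) 2 ((M.P - 2 - j) / 3)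
      (by change M.P = _; omega)
    rw [transpose_total] at this
    simp only [sum_range_succ, sum_range_zero, transpose_col] at this
    rw [show 3 * (j / 3) = j by omega] at this
    simpa using this
  rcases (by omega : i % 3 = 0 ∨ i % 3 = 1 ∨ i % 3 = 2) with m | m | m
  · have h1 := split i hi.1 m hi.2.1
    have h2 := h.row_ge hQ (j := i) (by omega)
    have h3 := h.row_ge hQ (j := i + 1) (by omega)
    omega
  · have h1 := split (i - 1) (by omega) (by omega) (by omega)
    have h2 := h.row_ge hQ (j := i) (by omega)
    have h3 := h.row_ge hQ (j := i - 1) (by omega)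
    rw [sub_add_cancel] at h1
    omega
  · have h1 := split (i + 1) (by omega) (by omega) (by omega)
    have h2 := h.sum_ge hQ
    have h3 := M.transpose.triple_nonneg hQ2 i
    rcases h3 with h3 | ⟨h3, -⟩
    · change 0 ≤ ∑ x ∈ Finset.range M.Q, (1 - (ind (M.E i x) + ind (M.E (i + 1) x)
        + ind (M.E (i + 2) x)) + ind (M.Z (i + 1) x)) at h3
      have hz : 0 ≤ ∑ x ∈ Finset.range M.Q, ind (M.Z (i + 2) x) :=
        sum_nonneg fun _ _ => ind_nonneg _
      rw [show i + 1 + 1 = i + 2 by ring] at h1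
      simp only [row, val, sum_add_distrib, sum_sub_distrib, ← mul_sum, sum_const, card_range,
        nsmul_eq_mul, mul_one] at h1 h3
      omega
    · change M.Q % 3 = 1 at h3
      omega

/-- If both numbers of windows are `2` modulo `3`, charging applies unless there is a jog. -/
theorem neg_four_le_total (hP : M.P % 3 = 2) (hQ : M.Q % 3 = 2) : -4 ≤ M.total := by
  by_cases hr : ∃ i, (M.toDomino hP hQ).Jog i
  · obtain ⟨i, hi⟩ := hr
    obtain ⟨x, hx⟩ := M.jogAt_of_jog _ rfl (fun _ _ h => h) hi
    linarith [hx.total_ge hP hQ]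
  by_cases hc : ∃ j, (M.toDomino hP hQ).transpose.Jog j
  · obtain ⟨j, hj⟩ := hc
    have hV : ∀ j i, (M.toDomino hP hQ).H i j → M.E i j ∧ ¬ M.E (i - 1) j ∧ ¬ M.E (i + 1) j := by
      rintro j i ⟨h, h'⟩
      rw [show j = j - 1 + 1 by ring] at h
      have h1 := M.not_below (i := i) (y := j - 1) h (by
        rwa [show j - 1 + 2 = j + 1 by ring])
      have h2 := M.not_above (i := i - 1) (y := j - 1) (by rwa [sub_add_cancel]) (by
        rwa [sub_add_cancel, show j - 1 + 2 = j + 1 by ring])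
      rw [sub_add_cancel] at h h1 h2
      exact ⟨h, h2.2.1, h1.2.1⟩
    obtain ⟨x, hx⟩ := M.transpose.jogAt_of_jog _ rfl hV hj
    have := hx.total_ge hQ hP
    rw [transpose_total] at this
    linarith
  push Not at hr hc
  have := Domino.neg_four_le hr hc
  refine this.trans ?_
  rw [total_eq]
  refine sum_le_sum fun r _ => sum_le_sum fun c _ => ?_
  rw [← ind_E_eq_toDomino, val]
  have := ind_nonneg (M.Z r c)
  linarith

end Board
end DomForcing

/-! ### The board of a connected dominating set -/

namespace DomForcing
open Finset

/-- Two cells of the square lattice share a side. -/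
def Adj4 (a b : ℤ × ℤ) : Prop :=
  (a.1 = b.1 ∧ (b.2 = a.2 + 1 ∨ a.2 = b.2 + 1)) ∨ (a.2 = b.2 ∧ (b.1 = a.1 + 1 ∨ a.1 = b.1 + 1))

/-- A connected dominating set of the `p × q` grid, as a set of cells `(i, j)` with `1 ≤ i ≤ p` and
`1 ≤ j ≤ q`. -/
structure ConnDom (p q : ℕ) (S : Finset (ℤ × ℤ)) : Prop where
  range : ∀ {i j}, (i, j) ∈ S → 1 ≤ i ∧ i ≤ p ∧ 1 ≤ j ∧ j ≤ q
  dom : ∀ i j : ℤ, 1 ≤ i → i ≤ p → 1 ≤ j → j ≤ q →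
    (i, j) ∈ S ∨ (i - 1, j) ∈ S ∨ (i + 1, j) ∈ S ∨ (i, j - 1) ∈ S ∨ (i, j + 1) ∈ S
  conn : ∀ a ∈ S, ∀ b ∈ S, Relation.ReflTransGen (fun u v => v ∈ S ∧ Adj4 u v) a b

variable {p q : ℕ} {S : Finset (ℤ × ℤ)}

/-- The window `(i, x)` contains no cell of `S`. -/
def EmptyWindow (p q : ℕ) (S : Finset (ℤ × ℤ)) (i x : ℤ) : Prop :=
  (0 ≤ i ∧ i < p + 1 ∧ 0 ≤ x ∧ x < q + 1) ∧ (i, x) ∉ S ∧ (i, x + 1) ∉ S ∧ (i + 1, x) ∉ S ∧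
    (i + 1, x + 1) ∉ S

/-- The window `(i, x)` is contained in `S` or meets `S` in two diagonally opposite cells. -/
def FullWindow (S : Finset (ℤ × ℤ)) (i x : ℤ) : Prop :=
  ((i, x) ∈ S ∧ (i + 1, x + 1) ∈ S ∧ ((i, x + 1) ∈ S ↔ (i + 1, x) ∈ S)) ∨
    ((i, x + 1) ∈ S ∧ (i + 1, x) ∈ S ∧ ((i, x) ∈ S ↔ (i + 1, x + 1) ∈ S))

/-- A connected set with cells on both sides of a column meets this column. -/
lemma ConnDom.crossing (h : ConnDom p q S) (hq : 6 ≤ q) (hp : 1 ≤ p)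
    (h3 : ∀ i, (i, 3) ∉ S) : False := by
  have h1 : ∃ a ∈ S, a.2 ≤ 2 := by
    rcases h.dom 1 1 (by omega) (by omega) (by omega) (by omega) with k | k | k | k | k <;>
    exact ⟨_, k, by simp⟩
  have h2 : ∃ a ∈ S, 5 ≤ a.2 := by
    rcases h.dom 1 q (by omega) (by omega) (by omega) (by omega) with k | k | k | k | k <;>
    exact ⟨_, k, by dsimp only; omega⟩
  obtain ⟨a, ha, ha2⟩ := h1
  obtain ⟨b, hb, hb2⟩ := h2
  have key : ∀ c, Relation.ReflTransGen (fun u v => v ∈ S ∧ Adj4 u v) a c → c.2 ≤ 2 := by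
    intro c hc
    induction hc with
    | refl => exact ha2
    | @tail u v _ huv ih =>
      obtain ⟨hv, huv⟩ := huv
      have hv3 : v.2 ≠ 3 := fun e => h3 v.1 (by rw [← e]; exact hv)
      unfold Adj4 at huv
      omega
  have := key b (h.conn a ha b hb)
  omega

lemma mem_map_swap {i j : ℤ} :
    (i, j) ∈ S.map (Equiv.prodComm ℤ ℤ).toEmbedding ↔ (j, i) ∈ S := by
  simp

/-- Reflection of the cells in the main diagonal. -/
lemma ConnDom.swap (h : ConnDom p q S) : ConnDom q p (S.map (Equiv.prodComm ℤ ℤ).toEmbedding) := by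
  refine ⟨fun {i j} hi => ?_, fun i j a b c d => ?_, fun a ha b hb => ?_⟩
  · have := h.range (mem_map_swap.1 hi)
    omega
  · simp only [mem_map_swap]
    have := h.dom j i c d a b
    tauto
  · have ha' := mem_map_swap.1 ha
    have hb' := mem_map_swap.1 hb
    have := h.conn _ ha' _ hb'
    refine Relation.ReflTransGen.lift Prod.swap ?_ _ _ this
    rintro ⟨u1, u2⟩ ⟨v1, v2⟩ ⟨hv, huv⟩
    refine ⟨mem_map_swap.2 hv, ?_⟩
    unfold Adj4 at *
    tauto

/-- The board of the windows of a connected dominating set. -/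
def ConnDom.board (h : ConnDom p q S) (hp : 4 ≤ p) (hq : 4 ≤ q) : Board where
  P := p + 1
  Q := q + 1
  E := EmptyWindow p q S
  Z := FullWindow S
  range h := by have := h.1; push_cast; omega
  diag := by
    rintro i x ⟨h1, h2, h3, h4, h5⟩ ⟨k1, k2, k3, k4, k5⟩
    have := h.dom (i + 1) (x + 1) (by omega) (by omega) (by omega) (by omega)
    simp only [add_sub_cancel_right] at this
    tauto
  diag' := by
    rintro i x ⟨h1, h2, h3, h4, h5⟩ ⟨k1, k2, k3, k4, k5⟩
    have := h.dom (i + 1) (x + 1) (by omega) (by omega) (by omega) (by omega)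
    simp only [add_sub_cancel_right] at this
    tauto
  gap_h := by
    rintro i x ⟨h1, h2, h3, h4, h5⟩ ⟨k1, k2, k3, k4, k5⟩
    rw [show x + 2 = x + 1 + 1 by ring] at k2 k4
    exact ⟨by omega, h3, k2, h5, k4⟩
  gap_v := by
    rintro i x ⟨h1, h2, h3, h4, h5⟩ ⟨k1, k2, k3, k4, k5⟩
    rw [show i + 2 = i + 1 + 1 by ring] at k2 k3
    exact ⟨by omega, h4, h5, k2, k3⟩
  left := by
    rintro i ⟨h1, h2, h3, h4, h5⟩
    exact ⟨by omega, fun k => by have := h.range k; omega, h2, fun k => by have := h.range k; omega,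
      h4⟩
  right := by
    rintro i ⟨h1, h2, h3, h4, h5⟩
    push_cast at *
    rw [show (q : ℤ) + 1 - 2 + 1 = q + 1 - 1 by ring] at *
    exact ⟨by omega, h3, fun k => by have := h.range k; omega, h5,
      fun k => by have := h.range k; omega⟩
  top := by
    rintro i ⟨h1, h2, h3, h4, h5⟩
    exact ⟨by omega, fun k => by have := h.range k; omega, fun k => by have := h.range k; omega,
      h2, h3⟩
  bottom := by
    rintro i ⟨h1, h2, h3, h4, h5⟩
    push_cast at *
    rw [show (p : ℤ) + 1 - 2 + 1 = p + 1 - 1 by ring] at *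
    exact ⟨by omega, h4, h5, fun k => by have := h.range k; omega,
      fun k => by have := h.range k; omega⟩
  full_v := by
    rintro i x ⟨h1, h2, h3, h4, h5⟩ ⟨k1, k2, k3, k4, k5⟩ ⟨l1, l2, l3, l4, l5⟩
      ⟨h1', h2', h3', h4', h5'⟩ ⟨k1', k2', k3', k4', k5'⟩ ⟨l1', l2', l3', l4', l5'⟩
    have d1 := h.dom (i + 1) (x + 1) (by omega) (by omega) (by omega) (by omega)
    have d2 := h.dom (i + 1) (x + 2) (by omega) (by omega) (by omega) (by omega)
    have d3 := h.dom (i + 4) (x + 1) (by omega) (by omega) (by omega) (by omega)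
    have d4 := h.dom (i + 4) (x + 2) (by omega) (by omega) (by omega) (by omega)
    unfold FullWindow
    rw [show x + 1 + 1 = x + 2 by ring, show i + 2 + 1 = i + 3 by ring] at *
    rw [show i + 1 + 1 = i + 2 by ring, show x + 1 - 1 = x by ring,
      show i + 1 - 1 = i by ring] at d1
    rw [show i + 1 + 1 = i + 2 by ring, show x + 2 - 1 = x + 1 by ring,
      show i + 1 - 1 = i by ring] at d2
    rw [show i + 4 - 1 = i + 3 by ring, show x + 1 - 1 = x by ring] at d3
    rw [show i + 4 - 1 = i + 3 by ring, show x + 2 - 1 = x + 1 by ring] at d4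
    have c1 : (i + 2, x + 1) ∈ S := by simpa [h3, h4, h5, k5] using d1
    have c2 : (i + 2, x + 2) ∈ S := by simpa [k3, h5, k5, l5] using d2
    have c3 : (i + 3, x + 1) ∈ S := by simpa [h2', h3', k3', h5'] using d3
    have c4 : (i + 3, x + 2) ∈ S := by simpa [k3', h3', l3', k5'] using d4
    exact Or.inl ⟨c1, c4, iff_of_true c2 c3⟩
  full_h := by
    rintro i x ⟨h1, h2, h3, h4, h5⟩ ⟨k1, k2, k3, k4, k5⟩ ⟨l1, l2, l3, l4, l5⟩
      ⟨h1', h2', h3', h4', h5'⟩ ⟨k1', k2', k3', k4', k5'⟩ ⟨l1', l2', l3', l4', l5'⟩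
    have d1 := h.dom (i + 1) (x + 1) (by omega) (by omega) (by omega) (by omega)
    have d2 := h.dom (i + 2) (x + 1) (by omega) (by omega) (by omega) (by omega)
    have d3 := h.dom (i + 1) (x + 4) (by omega) (by omega) (by omega) (by omega)
    have d4 := h.dom (i + 2) (x + 4) (by omega) (by omega) (by omega) (by omega)
    unfold FullWindow
    rw [show i + 1 + 1 = i + 2 by ring, show x + 2 + 1 = x + 3 by ring] at *
    rw [show x + 1 + 1 = x + 2 by ring, show i + 1 - 1 = i by ring,
      show x + 1 - 1 = x by ring] at d1
    rw [show x + 1 + 1 = x + 2 by ring, show i + 2 - 1 = i + 1 by ring,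
      show x + 1 - 1 = x by ring] at d2
    rw [show x + 4 - 1 = x + 3 by ring, show i + 1 - 1 = i by ring] at d3
    rw [show x + 4 - 1 = x + 3 by ring, show i + 2 - 1 = i + 1 by ring] at d4
    have c1 : (i + 1, x + 2) ∈ S := by simpa [h3, h4, h5, k5] using d1
    have c2 : (i + 2, x + 2) ∈ S := by simpa [k4, h5, k5, l5] using d2
    have c3 : (i + 1, x + 3) ∈ S := by simpa [h2', h4', k4', h5'] using d3
    have c4 : (i + 2, x + 3) ∈ S := by simpa [k4', h4', l4', k5'] using d4
    exact Or.inl ⟨c1, c4, iff_of_true c3 c2⟩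
  no_col hQ hc := by
    refine h.crossing (by omega) (by omega) fun i hi => ?_
    have := h.range hi
    exact (hc i (by omega) (by push_cast; omega)).2.1 hi
  no_row hP hc := by
    refine h.swap.crossing (by omega) (by omega) fun i hi => ?_
    rw [mem_map_swap] at hi
    have := h.range hi
    exact (hc i (by omega) (by push_cast; omega)).2.1 hi

end DomForcing

/-! ### The Euler characteristic and the lower bounds -/

namespace DomForcing
open Finset

variable {p q : ℕ} {S : Finset (ℤ × ℤ)}

/-- The cells of `S` whose lower neighbour belongs to `S`. -/
def downEdges (S : Finset (ℤ × ℤ)) : Finset (ℤ × ℤ) := {a ∈ S | (a.1 + 1, a.2) ∈ S}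

/-- The cells of `S` whose right neighbour belongs to `S`. -/
def rightEdges (S : Finset (ℤ × ℤ)) : Finset (ℤ × ℤ) := {a ∈ S | (a.1, a.2 + 1) ∈ S}

/-- The upper left cells of the `2 × 2` blocks contained in `S`. -/
def blocks (S : Finset (ℤ × ℤ)) : Finset (ℤ × ℤ) :=
  {a ∈ S | (a.1, a.2 + 1) ∈ S ∧ (a.1 + 1, a.2) ∈ S ∧ (a.1 + 1, a.2 + 1) ∈ S}

/-- A connected set of cells has Euler characteristic at most `1`: the upper horizontal edge of each
full `2 × 2` block may be deleted without disconnecting the set. -/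
theorem ConnDom.euler (h : ConnDom p q S) (hp : 1 ≤ p) (hq : 1 ≤ q) :
    #S + #(blocks S) ≤ #(rightEdges S) + #(downEdges S) + 1 := by
  classical
  -- `A` and `B` index the edges that are kept, by their upper and left ends
  let dn : S → S := fun u => if h : (u.1.1 + 1, u.1.2) ∈ S then ⟨_, h⟩ else u
  let rt : S → S := fun u => if h : (u.1.1, u.1.2 + 1) ∈ S then ⟨_, h⟩ else u
  let A : Finset S := {u | u.1 ∈ downEdges S}
  let B : Finset S := {u | u.1 ∈ rightEdges S \ blocks S}
  let G : SimpleGraph S := SimpleGraph.fromRel fun u v => (u ∈ A ∧ v = dn u) ∨ (u ∈ B ∧ v = rt u)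
  have hdown : ∀ a (ha : a ∈ S) (ha' : (a.1 + 1, a.2) ∈ S), G.Reachable ⟨a, ha⟩ ⟨_, ha'⟩ := by
    intro a ha ha'
    refine SimpleGraph.Adj.reachable ?_
    rw [SimpleGraph.fromRel_adj]
    refine ⟨fun e => ?_, Or.inl (Or.inl ⟨?_, ?_⟩)⟩
    · have := congrArg (fun u : S => u.1.1) e
      dsimp only at this
      omega
    · simp [A, downEdges, ha']
    · simp [dn, ha']
  -- induction from the bottom row upwards: a deleted edge is replaced by the other three sides of
  -- its block, and the lower side is available by induction
  have hright : ∀ n : ℕ, ∀ a (ha : a ∈ S) (ha' : (a.1, a.2 + 1) ∈ S), (p : ℤ) - a.1 ≤ n →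
      G.Reachable ⟨a, ha⟩ ⟨_, ha'⟩ := by
    intro n
    induction n with
    | zero =>
      intro a ha ha' hn
      refine SimpleGraph.Adj.reachable ?_
      rw [SimpleGraph.fromRel_adj]
      refine ⟨fun e => ?_, Or.inl (Or.inr ⟨?_, ?_⟩)⟩
      · have := congrArg (fun u : S => u.1.2) e
        dsimp only at this
        omega
      · have : (a.1 + 1, a.2) ∉ S := fun hc => by have := h.range hc; push_cast at hn; omega
        simp [B, rightEdges, blocks, ha', this]
      · simp [rt, ha']
    | succ n ih =>
      intro a ha ha' hn
      by_cases hb : a ∈ blocks S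
      · have hb' := (mem_filter.1 hb).2
        have h1 := ih (a.1 + 1, a.2) hb'.2.1 hb'.2.2 (by push_cast at hn ⊢; omega)
        exact ((hdown a ha hb'.2.1).trans h1).trans (hdown _ ha' hb'.2.2).symm
      · refine SimpleGraph.Adj.reachable ?_
        rw [SimpleGraph.fromRel_adj]
        refine ⟨fun e => ?_, Or.inl (Or.inr ⟨?_, ?_⟩)⟩
        · have := congrArg (fun u : S => u.1.2) e
          dsimp only at this
          omega
        · simp [B, rightEdges, ha', hb]
        · simp [rt, ha']
  have hadj : ∀ a b (ha : a ∈ S) (hb : b ∈ S), Adj4 a b → G.Reachable ⟨a, ha⟩ ⟨b, hb⟩ := by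
    rintro ⟨a1, a2⟩ ⟨b1, b2⟩ ha hb (⟨h1, h2 | h2⟩ | ⟨h1, h2 | h2⟩) <;> dsimp only at h1 h2 <;>
      subst h1 h2
    · exact hright (p - a1).toNat _ ha hb (Int.self_le_toNat _)
    · exact (hright (p - a1).toNat _ hb ha (Int.self_le_toNat _)).symm
    · exact hdown _ ha hb
    · exact (hdown _ hb ha).symm
  have hconn : G.Connected := by
    have hne : S.Nonempty := by
      rcases h.dom 1 1 (by omega) (by omega) (by omega) (by omega) with k | k | k | k | k <;>
        exact ⟨_, k⟩
    have : Nonempty S := hne.to_subtype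
    refine ⟨fun a b => ?_⟩
    have := h.conn a a.2 b b.2
    have key : ∀ c, Relation.ReflTransGen (fun u v => v ∈ S ∧ Adj4 u v) a.1 c →
        ∃ hc : c ∈ S, G.Reachable a ⟨c, hc⟩ := by
      intro c hc
      induction hc with
      | refl => exact ⟨a.2, SimpleGraph.Reachable.refl _⟩
      | tail _ huv ih =>
        obtain ⟨hu, ih⟩ := ih
        exact ⟨huv.1, ih.trans (hadj _ _ hu huv.1 huv.2)⟩
    exact (key b this).2
  have hcard := hconn.card_vert_le_card_edgeSet_add_one
  have hsub : G.edgeSet ⊆ ((A.image fun u => s(u, dn u)) ∪ B.image fun u => s(u, rt u) :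
      Finset (Sym2 S)) := by
    intro e
    induction e with
    | _ u v =>
      rw [SimpleGraph.mem_edgeSet, SimpleGraph.fromRel_adj]
      simp only [coe_union, coe_image, Set.mem_union, Set.mem_image, mem_coe]
      rintro ⟨-, (⟨h1, h2⟩ | ⟨h1, h2⟩) | (⟨h1, h2⟩ | ⟨h1, h2⟩)⟩
      · exact Or.inl ⟨u, h1, by rw [h2]⟩
      · exact Or.inr ⟨u, h1, by rw [h2]⟩
      · exact Or.inl ⟨v, h1, by rw [h2]; exact Sym2.eq_swap⟩
      · exact Or.inr ⟨v, h1, by rw [h2]; exact Sym2.eq_swap⟩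
  have h1 : Nat.card G.edgeSet ≤ #A + #B := by
    refine (Nat.card_mono (finite_toSet _) hsub).trans ?_
    rw [Nat.card_coe_set_eq, Set.ncard_coe_finset]
    exact (card_union_le _ _).trans (add_le_add card_image_le card_image_le)
  have h2 : #A ≤ #(downEdges S) :=
    card_le_card_of_injOn Subtype.val (fun u hu => by simpa [A] using hu)
      Subtype.val_injective.injOn
  have h3 : #B ≤ #(rightEdges S \ blocks S) :=
    card_le_card_of_injOn Subtype.val (fun u hu => by simpa [B] using hu)
      Subtype.val_injective.injOn
  have h4 : #(rightEdges S \ blocks S) + #(blocks S) = #(rightEdges S) :=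
    card_sdiff_add_card_eq_card (by
      intro a
      simp only [blocks, rightEdges, mem_filter]
      tauto)
  rw [Nat.card_eq_fintype_card, Fintype.card_coe] at hcard
  omega

lemma sum_ind_mem {P Q : ℕ} {T : Finset (ℤ × ℤ)}
    (hT : ∀ a ∈ T, 0 ≤ a.1 ∧ a.1 < P ∧ 0 ≤ a.2 ∧ a.2 < Q) :
    ∑ i ∈ Finset.range P, ∑ x ∈ Finset.range Q, ind (((i : ℤ), (x : ℤ)) ∈ T) = #T := by
  classical
  rw [← sum_product', Domino.sum_ind_eq_card (Finset.range P ×ˢ Finset.range Q)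
    fun a : ℕ × ℕ => ((a.1 : ℤ), (a.2 : ℤ)) ∈ T]
  congr 1
  refine card_bij (fun a _ => ((a.1 : ℤ), (a.2 : ℤ))) ?_ ?_ ?_
  · intro a ha
    exact (mem_filter.1 ha).2
  · intro a _ b _ hab
    simp only [Prod.mk.injEq, Nat.cast_inj] at hab
    exact Prod.ext hab.1 hab.2
  · rintro ⟨i, x⟩ h
    obtain ⟨h1, h2, h3, h4⟩ := hT _ h
    dsimp only at h1 h2 h3 h4
    lift i to ℕ using h1
    lift x to ℕ using h3
    exact ⟨(i, x), by simp [h]; omega, rfl⟩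

/-- The cells of a set may be counted with any offset by which the summation reaches all of them. -/
lemma sum_ind_mem_shift {P Q : ℕ} {T : Finset (ℤ × ℤ)} (s t : ℤ)
    (hT : ∀ a ∈ T, s ≤ a.1 ∧ a.1 < P + s ∧ t ≤ a.2 ∧ a.2 < Q + t) :
    ∑ i ∈ Finset.range P, ∑ x ∈ Finset.range Q, ind (((i : ℤ) + s, (x : ℤ) + t) ∈ T) = #T := by
  have := sum_ind_mem (P := P) (Q := Q)
    (T := T.map (Equiv.subRight ((s, t) : ℤ × ℤ)).toEmbedding) (by
      intro a ha
      obtain ⟨b, hb, rfl⟩ := mem_map.1 ha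
      have := hT b hb
      simp
      omega)
  rw [card_map] at this
  rw [← this]
  refine sum_congr rfl fun i _ => sum_congr rfl fun x _ => ?_
  congr 1
  simp

/-- The number of cells, edges and blocks in a window determine its excess. -/
lemma ConnDom.val_eq (h : ConnDom p q S) (hp : 4 ≤ p) (hq : 4 ≤ q) {i x : ℤ}
    (hi : 0 ≤ i ∧ i < p + 1 ∧ 0 ≤ x ∧ x < q + 1) :
    (h.board hp hq).val i x =
      3 * (ind ((i + 0, x + 0) ∈ S) + ind ((i + 0, x + 1) ∈ S) + ind ((i + 1, x + 0) ∈ S)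
        + ind ((i + 1, x + 1) ∈ S)
        - ind ((i + 0, x + 0) ∈ rightEdges S) - ind ((i + 1, x + 0) ∈ rightEdges S)
        - ind ((i + 0, x + 0) ∈ downEdges S) - ind ((i + 0, x + 1) ∈ downEdges S)
        + 2 * ind ((i + 0, x + 0) ∈ blocks S)) - 2 := by
  have hE : ind ((h.board hp hq).E i x) = ind (EmptyWindow p q S i x) := rfl
  have hZ : ind ((h.board hp hq).Z i x) = ind (FullWindow S i x) := rfl
  rw [Board.val, hE, hZ]
  simp only [EmptyWindow, hi, FullWindow, rightEdges, downEdges, blocks, mem_filter, add_zero]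
  by_cases a : (i, x) ∈ S <;> by_cases b : (i, x + 1) ∈ S <;> by_cases c : (i + 1, x) ∈ S <;>
    by_cases d : (i + 1, x + 1) ∈ S <;> simp [a, b, c, d, ind]

/-- The excess of all windows in terms of the number of cells. -/
theorem ConnDom.total_le (h : ConnDom p q S) (hp : 4 ≤ p) (hq : 4 ≤ q) :
    (h.board hp hq).total ≤ 6 * (#S + 1) - 2 * ((p + 1) * (q + 1)) := by
  have hr : ∀ {T : Finset (ℤ × ℤ)}, T ⊆ S → ∀ a ∈ T, 1 ≤ a.1 ∧ a.1 ≤ p ∧ 1 ≤ a.2 ∧ a.2 ≤ q :=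
    fun hT a ha => h.range (hT ha)
  have hsum : ∀ {T : Finset (ℤ × ℤ)} (s t : ℤ), T ⊆ S → (s = 0 ∨ s = 1) → (t = 0 ∨ t = 1) →
      ∑ i ∈ Finset.range (p + 1), ∑ x ∈ Finset.range (q + 1), ind (((i : ℤ) + s, (x : ℤ) + t) ∈ T)
        = #T := by
    intro T s t hT hs ht
    refine sum_ind_mem_shift s t fun a ha => ?_
    have := hr hT a ha
    push_cast
    omega
  have hR : rightEdges S ⊆ S := filter_subset _ _
  have hD : downEdges S ⊆ S := filter_subset _ _
  have hB : blocks S ⊆ S := filter_subset _ _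
  have h1 : (h.board hp hq).total = ∑ i ∈ Finset.range (p + 1), ∑ x ∈ Finset.range (q + 1),
      (3 * (ind (((i : ℤ) + 0, (x : ℤ) + 0) ∈ S) + ind (((i : ℤ) + 0, (x : ℤ) + 1) ∈ S)
        + ind (((i : ℤ) + 1, (x : ℤ) + 0) ∈ S) + ind (((i : ℤ) + 1, (x : ℤ) + 1) ∈ S)
        - ind (((i : ℤ) + 0, (x : ℤ) + 0) ∈ rightEdges S)
        - ind (((i : ℤ) + 1, (x : ℤ) + 0) ∈ rightEdges S)
        - ind (((i : ℤ) + 0, (x : ℤ) + 0) ∈ downEdges S)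
        - ind (((i : ℤ) + 0, (x : ℤ) + 1) ∈ downEdges S)
        + 2 * ind (((i : ℤ) + 0, (x : ℤ) + 0) ∈ blocks S)) - 2) := by
    rw [Board.total_eq]
    refine sum_congr rfl fun i hi => sum_congr rfl fun x hx => h.val_eq hp hq ?_
    have hi' : i < p + 1 := mem_range.1 hi
    have hx' : x < q + 1 := mem_range.1 hx
    omega
  simp only [sum_sub_distrib, sum_add_distrib, ← mul_sum] at h1
  rw [hsum 0 0 subset_rfl (by simp) (by simp), hsum 0 1 subset_rfl (by simp) (by simp),
    hsum 1 0 subset_rfl (by simp) (by simp), hsum 1 1 subset_rfl (by simp) (by simp),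
    hsum 0 0 hR (by simp) (by simp), hsum 1 0 hR (by simp) (by simp),
    hsum 0 0 hD (by simp) (by simp), hsum 0 1 hD (by simp) (by simp),
    hsum 0 0 hB (by simp) (by simp)] at h1
  have h2 := h.euler (by omega) (by omega)
  have h3 : ((#S + #(blocks S) : ℕ) : ℤ) ≤ (#(rightEdges S) + #(downEdges S) + 1 : ℕ) := by
    exact_mod_cast h2
  push_cast at h3
  rw [h1]
  simp only [sum_const, card_range, nsmul_eq_mul]
  push_cast
  linarith

/-- Lower bound for the size of a connected dominating set, when `3` divides neither side. -/
theorem ConnDom.le_of_not_dvd (h : ConnDom p q S) (hp : 4 ≤ p) (hq : 4 ≤ q) (hp3 : p % 3 ≠ 0)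
    (hq3 : q % 3 ≠ 0) : p * q + p + q ≤ 3 * #S + 3 := by
  have h1 := h.total_le hp hq
  have hP : (h.board hp hq).P = p + 1 := rfl
  have hQ : (h.board hp hq).Q = q + 1 := rfl
  have h2 : -4 ≤ (h.board hp hq).total := by
    by_cases a : (q + 1) % 3 = 0
    · linarith [(h.board hp hq).total_nonneg_of_mod_zero (by omega) (by omega) a]
    by_cases b : (p + 1) % 3 = 0
    · have := (h.board hp hq).transpose.total_nonneg_of_mod_zero (by change 2 ≤ q + 1; omega)
        (by change (q + 1) % 3 ≠ 1; omega) b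
      rw [Board.transpose_total] at this
      linarith
    · exact (h.board hp hq).neg_four_le_total (by omega) (by omega)
  have h3 : ((p : ℤ) * q + p + q) ≤ 3 * #S + 4 := by linarith
  have h4 : p * q + p + q ≤ 3 * #S + 4 := by exact_mod_cast h3
  -- equality is impossible, since `(p + 1) * (q + 1)` is `0` or `1` modulo `3`
  by_contra hc
  have h5 : p * q + p + q = 3 * #S + 4 := by omega
  have h6 : (p * q + p + q) % 3 = 1 := by omega
  have h7 : (p + 1) * (q + 1) % 3 = 2 := by
    rw [show (p + 1) * (q + 1) = p * q + p + q + 1 by ring]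
    omega
  rw [Nat.mul_mod] at h7
  rcases (by omega : (p + 1) % 3 = 2 ∨ (p + 1) % 3 = 0) with e | e <;>
  rcases (by omega : (q + 1) % 3 = 2 ∨ (q + 1) % 3 = 0) with e' | e' <;> rw [e, e'] at h7 <;>
  omega

lemma card_ge_of_total_gt {p q n : ℕ} {T : ℤ} (hq3 : q % 3 = 0)
    (h1 : T ≤ 6 * (n + 1) - 2 * ((p + 1) * (q + 1))) (hT : -2 * ((p : ℤ) + 1) < T) :
    p * q + q ≤ 3 * n := by
  have h2 : (p : ℤ) * q + q < 3 * n + 3 := by nlinarith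
  have h3 : p * q + q < 3 * n + 3 := by exact_mod_cast h2
  obtain ⟨k, rfl⟩ := Nat.dvd_of_mod_eq_zero hq3
  have h4 : p * (3 * k) + 3 * k = 3 * (p * k + k) := by ring
  omega

/-- Lower bound for the size of a connected dominating set, when `3` divides `q`. -/
theorem ConnDom.le_of_dvd (h : ConnDom p q S) (hp : 4 ≤ p) (hq : 4 ≤ q) (hp3 : p % 3 ≠ 0)
    (hq3 : q % 3 = 0) : p * q + q ≤ 3 * #S := by
  refine card_ge_of_total_gt hq3 (h.total_le hp hq) ?_
  have := (h.board hp hq).total_gt_of_mod_one (by change 2 ≤ p + 1; omega)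
    (fun h' => by change (p + 1) % 3 = 1 at h'; omega) (by change (q + 1) % 3 = 1; omega)
    (by change 5 ≤ q + 1; omega)
  change -2 * ((p + 1 : ℕ) : ℤ) < _ at this
  exact_mod_cast this

/-- Lower bound for the size of a connected dominating set, when `3` divides both sides. -/
theorem ConnDom.le_of_dvd_dvd (h : ConnDom p q S) (hp : 4 ≤ p) (hq : 4 ≤ q) (hp3 : p % 3 = 0)
    (hq3 : q % 3 = 0) : p * q + q ≤ 3 * #S ∨ p * q + p ≤ 3 * #S := by
  by_cases hc : ∃ y, (h.board hp hq).PerfectCol y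
  · right
    obtain ⟨y, hy⟩ := hc
    have h0 : (p + 1) % 3 = 1 := by omega
    have h0' : (q + 1) % 3 = 1 := by omega
    have h1 := h.total_le hp hq
    have h2 := (h.board hp hq).transpose.total_gt_of_mod_one (by change 2 ≤ q + 1; omega)
      (fun _ r hr => (h.board hp hq).not_perfectCol_of_perfectRow h0 h0' hy hr)
      h0 (by change 5 ≤ p + 1; omega)
    rw [Board.transpose_total] at h2
    change -2 * ((q + 1 : ℕ) : ℤ) < _ at h2
    rw [mul_comm]
    refine card_ge_of_total_gt (T := (h.board hp hq).total) hp3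
      (by rw [mul_comm ((q : ℤ) + 1)]; exact h1) ?_
    exact_mod_cast h2
  · left
    push Not at hc
    refine card_ge_of_total_gt hq3 (h.total_le hp hq) ?_
    have := (h.board hp hq).total_gt_of_mod_one (by change 2 ≤ p + 1; omega)
      (fun _ => hc) (by change (q + 1) % 3 = 1; omega) (by change 5 ≤ q + 1; omega)
    change -2 * ((p + 1 : ℕ) : ℤ) < _ at this
    exact_mod_cast this

end DomForcing

/-! ### The comb -/

namespace DomForcing
open Finset

variable {p q : ℕ}

lemma grid_adj {a b : Fin p × Fin q} : (grid p q).Adj a b ↔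
    ((a.1.1 + 1 = b.1.1 ∨ b.1.1 + 1 = a.1.1) ∧ a.2 = b.2) ∨
    ((a.2.1 + 1 = b.2.1 ∨ b.2.1 + 1 = a.2.1) ∧ a.1 = b.1) := by
  rw [grid, SimpleGraph.boxProd_adj, SimpleGraph.pathGraph_adj, SimpleGraph.pathGraph_adj]

/-- The cell of the square lattice that represents a vertex of the grid. -/
def cell : Fin p × Fin q ↪ ℤ × ℤ where
  toFun a := ((a.1.1 : ℤ) + 1, (a.2.1 : ℤ) + 1)
  inj' a b h := by
    simp only [Prod.mk.injEq] at h
    exact Prod.ext (Fin.ext (by omega)) (Fin.ext (by omega))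

lemma cell_apply (a : Fin p × Fin q) : cell a = ((a.1.1 : ℤ) + 1, (a.2.1 : ℤ) + 1) := rfl

lemma mem_map_cell {D : Finset (Fin p × Fin q)} {i j : ℤ} : (i, j) ∈ D.map cell ↔
    ∃ a ∈ D, (a.1.1 : ℤ) + 1 = i ∧ (a.2.1 : ℤ) + 1 = j := by
  simp [cell_apply]

lemma adj4_cell {a b : Fin p × Fin q} (h : (grid p q).Adj a b) : Adj4 (cell a) (cell b) := by
  rw [grid_adj] at h
  simp only [Adj4, cell_apply]
  rw [Fin.ext_iff, Fin.ext_iff] at h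
  omega

/-- A connected dominating set of the grid graph, as a set of cells. -/
theorem connDom_of_isConnectedDominating {D : Finset (Fin p × Fin q)}
    (h : IsConnectedDominating (grid p q) D) : ConnDom p q (D.map cell) where
  range := by
    intro i j hij
    obtain ⟨a, -, h1, h2⟩ := mem_map_cell.1 hij
    have := a.1.2
    have := a.2.2
    omega
  dom := by
    intro i j hi hi' hj hj'
    obtain ⟨i, rfl⟩ : ∃ n : ℕ, i = n + 1 := ⟨(i - 1).toNat, by omega⟩
    obtain ⟨j, rfl⟩ : ∃ n : ℕ, j = n + 1 := ⟨(j - 1).toNat, by omega⟩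
    simp only [mem_map_cell]
    rcases h.1 (⟨i, by omega⟩, ⟨j, by omega⟩) with k | ⟨u, hu, k⟩
    · exact Or.inl ⟨_, k, rfl, rfl⟩
    · rw [grid_adj, Fin.ext_iff, Fin.ext_iff] at k
      dsimp only at k
      rcases k with ⟨k | k, k'⟩ | ⟨k | k, k'⟩
      · exact Or.inr (Or.inl ⟨u, hu, by omega, by omega⟩)
      · exact Or.inr (Or.inr (Or.inl ⟨u, hu, by omega, by omega⟩))
      · exact Or.inr (Or.inr (Or.inr (Or.inl ⟨u, hu, by omega, by omega⟩)))
      · exact Or.inr (Or.inr (Or.inr (Or.inr ⟨u, hu, by omega, by omega⟩)))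
  conn := by
    intro a ha b hb
    obtain ⟨a, ha', rfl⟩ := mem_map.1 ha
    obtain ⟨b, hb', rfl⟩ := mem_map.1 hb
    obtain ⟨w⟩ := h.2.preconnected ⟨a, ha'⟩ ⟨b, hb'⟩
    have key : ∀ {u v : (D : Set (Fin p × Fin q))}, ((grid p q).induce (D : Set _)).Walk u v →
        Relation.ReflTransGen (fun u v => v ∈ D.map cell ∧ Adj4 u v) (cell u.1) (cell v.1) := by
      intro u v w
      induction w with
      | nil => exact Relation.ReflTransGen.refl
      | @cons u v _ huv _ ih =>
        exact Relation.ReflTransGen.head ⟨mem_map_of_mem _ v.2, adj4_cell huv⟩ ih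
    exact key w

section Iso

variable {V W : Type*} {G : SimpleGraph V} {H : SimpleGraph W}

lemma Black.map (e : G ≃g H) {Z : Finset V} {v : V} (h : Black G Z v) :
    Black H (Z.map e.toEquiv.toEmbedding) (e v) := by
  induction h with
  | initial hv => exact Black.initial (mem_map_of_mem _ hv)
  | @force u v _ huv _ ihu ih =>
    refine Black.force ihu (e.map_adj_iff.2 huv) fun w hw hne => ?_
    have := ih (e.symm w) (by rw [← e.map_adj_iff]; simpa using hw)
      (fun h => hne (by rw [← h]; simp))
    simpa using this

theorem IsConnectedDomForcing.map (e : G ≃g H) {D : Finset V} (h : IsConnectedDomForcing G D) :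
    IsConnectedDomForcing H (D.map e.toEquiv.toEmbedding) := by
  have hc : (H.induce (D.map e.toEquiv.toEmbedding : Set W)).Connected := by
    have hc := h.1.2
    have key : ∀ {u v : (D : Set V)}, (G.induce (D : Set V)).Reachable u v →
        (H.induce (D.map e.toEquiv.toEmbedding : Set W)).Reachable
          ⟨e u.1, mem_map_of_mem _ u.2⟩ ⟨e v.1, mem_map_of_mem _ v.2⟩ := by
      rintro u v ⟨w⟩
      induction w with
      | nil => exact SimpleGraph.Reachable.refl _
      | cons huv _ ih =>
        refine (SimpleGraph.Adj.reachable ?_).trans ih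
        exact e.map_adj_iff.2 huv
    have hne := hc.nonempty
    obtain ⟨a⟩ := hne
    have : Nonempty (D.map e.toEquiv.toEmbedding : Set W) := ⟨e a.1, mem_map_of_mem _ a.2⟩
    refine ⟨?_⟩
    rintro ⟨u, hu⟩ ⟨v, hv⟩
    obtain ⟨u, hu', rfl⟩ := mem_map.1 hu
    obtain ⟨v, hv', rfl⟩ := mem_map.1 hv
    exact key (hc.preconnected ⟨u, hu'⟩ ⟨v, hv'⟩)
  refine ⟨⟨fun v => ?_, hc⟩, fun v => ?_, hc⟩
  · rcases h.1.1 (e.symm v) with k | ⟨u, hu, k⟩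
    · exact Or.inl (mem_map.2 ⟨_, k, by simp⟩)
    · refine Or.inr ⟨e u, mem_map_of_mem _ hu, ?_⟩
      have := e.map_adj_iff.2 k
      simpa using this
  · have := (h.2.1 (e.symm v)).map e
    simpa using this

end Iso

/-- Exchange of the two sides of the grid. -/
theorem exists_swap {n : ℕ} (h : ∃ D, IsConnectedDomForcing (grid p q) D ∧ #D ≤ n) :
    ∃ D, IsConnectedDomForcing (grid q p) D ∧ #D ≤ n := by
  obtain ⟨D, h, hn⟩ := h
  exact ⟨_, h.map (SimpleGraph.boxProdComm _ _), by rwa [card_map]⟩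

/-- The comb: a spine in row `1`, teeth in the columns `1, 4, 7, …`, the cell below the right end of
the spine and, if the last column is not dominated by the teeth, pegs of length two in every third
row, which join the last column to the last tooth. Rows and columns are numbered from `0`. -/
def Comb (q r c : ℕ) : Prop :=
  r = 1 ∨ (2 ≤ r ∧ c % 3 = 1) ∨ (r = 2 ∧ c + 1 = q) ∨ (q % 3 = 1 ∧ r % 3 = 2 ∧ 5 ≤ r ∧ q ≤ c + 2)

instance (q r c : ℕ) : Decidable (Comb q r c) := by unfold Comb; infer_instance

/-- The comb `Comb` as a set of vertices of the grid. -/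
def comb (p q : ℕ) : Finset (Fin p × Fin q) := {v | Comb q v.1.1 v.2.1}

lemma mem_comb {v : Fin p × Fin q} : v ∈ comb p q ↔ Comb q v.1.1 v.2.1 := by simp [comb]

lemma comb_dominating (hp : 4 ≤ p) (h : q % 3 = 1 → p % 3 = 1) :
    IsDominating (grid p q) (comb p q) := by
  rintro ⟨⟨r, hr⟩, ⟨c, hc⟩⟩
  have key : Comb q r c ∨ (∃ r', r' < p ∧ (r' + 1 = r ∨ r + 1 = r') ∧ Comb q r' c) ∨
      (∃ c', c' < q ∧ (c' + 1 = c ∨ c + 1 = c') ∧ Comb q r c') := by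
    unfold Comb
    by_cases h0 : r ≤ 2
    · rcases (by omega : r = 0 ∨ r = 1 ∨ r = 2) with rfl | rfl | rfl
      · exact Or.inr (Or.inl ⟨1, by omega, by omega, by omega⟩)
      · exact Or.inl (by omega)
      · exact Or.inr (Or.inl ⟨1, by omega, by omega, by omega⟩)
    rcases (by omega : c % 3 = 1 ∨ c % 3 = 2 ∨ c % 3 = 0) with m | m | m
    · exact Or.inl (by omega)
    · exact Or.inr (Or.inr ⟨c - 1, by omega, by omega, by omega⟩)
    · by_cases hcq : c + 1 < q
      · exact Or.inr (Or.inr ⟨c + 1, by omega, by omega, by omega⟩)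
      · have h1 := h (by omega)
        rcases (by omega : r % 3 = 2 ∨ r % 3 = 0 ∨ r % 3 = 1) with n | n | n
        · exact Or.inl (by omega)
        · exact Or.inr (Or.inl ⟨r - 1, by omega, by omega, by omega⟩)
        · exact Or.inr (Or.inl ⟨r + 1, by omega, by omega, by omega⟩)
  rcases key with k | ⟨r', h1, h2, k⟩ | ⟨c', h1, h2, k⟩
  · exact Or.inl (mem_comb.2 k)
  · exact Or.inr ⟨(⟨r', h1⟩, ⟨c, hc⟩), mem_comb.2 k, grid_adj.2 (Or.inl ⟨h2, rfl⟩)⟩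
  · exact Or.inr ⟨(⟨r, hr⟩, ⟨c', h1⟩), mem_comb.2 k, grid_adj.2 (Or.inr ⟨h2, rfl⟩)⟩

lemma comb_connected (hp : 4 ≤ p) (hq : 4 ≤ q) :
    ((grid p q).induce (comb p q : Set (Fin p × Fin q))).Connected := by
  have h0 : ((⟨1, by omega⟩, ⟨0, by omega⟩) : Fin p × Fin q) ∈ comb p q :=
    mem_comb.2 (Or.inl rfl)
  have key : ∀ n : ℕ, ∀ v (hv : v ∈ comb p q), v.1.1 + v.2.1 ≤ n →
      ((grid p q).induce (comb p q : Set (Fin p × Fin q))).Reachable ⟨_, h0⟩ ⟨v, hv⟩ := by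
    intro n
    induction n with
    | zero =>
      intro v hv hn
      have := mem_comb.1 hv
      unfold Comb at this
      omega
    | succ n ih =>
      rintro ⟨⟨r, hr⟩, ⟨c, hc⟩⟩ hv hn
      by_cases he : r = 1 ∧ c = 0
      · obtain ⟨rfl, rfl⟩ := he
        exact SimpleGraph.Reachable.refl _
      have hv' := mem_comb.1 hv
      -- every other cell of the comb has its upper or its left neighbour in the comb
      have hpar : (2 ≤ r ∧ Comb q (r - 1) c) ∨ (1 ≤ c ∧ Comb q r (c - 1)) := by
        unfold Comb at *
        dsimp only at hv'
        rcases hv' with h | ⟨h, h'⟩ | ⟨h, h'⟩ | ⟨h, h1, h2, h3⟩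
        · exact Or.inr (by omega)
        · exact Or.inl (by omega)
        · exact Or.inl (by omega)
        · exact Or.inr (by omega)
      rcases hpar with ⟨h1, h2⟩ | ⟨h1, h2⟩
      · refine (ih (⟨r - 1, by omega⟩, ⟨c, hc⟩) (mem_comb.2 h2)
          (by dsimp only at hn ⊢; omega)).trans (SimpleGraph.Adj.reachable ?_)
        exact grid_adj.2 (Or.inl ⟨Or.inl (Nat.sub_add_cancel (by omega)), rfl⟩)
      · refine (ih (⟨r, hr⟩, ⟨c - 1, by omega⟩) (mem_comb.2 h2)
          (by dsimp only at hn ⊢; omega)).trans (SimpleGraph.Adj.reachable ?_)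
        exact grid_adj.2 (Or.inr ⟨Or.inl (Nat.sub_add_cancel (by omega)), rfl⟩)
  have : Nonempty (comb p q : Set (Fin p × Fin q)) := ⟨_, h0⟩
  exact ⟨fun u v => (key _ _ u.2 le_rfl).symm.trans (key _ _ v.2 le_rfl)⟩

lemma comb_zeroForcing (hp : 4 ≤ p) (hq : 4 ≤ q) : IsZeroForcing (grid p q) (comb p q) := by
  have h1 : ∀ c (hc : c < q), Black (grid p q) (comb p q) (⟨1, by omega⟩, ⟨c, hc⟩) := fun c hc =>
    Black.initial (mem_comb.2 (Or.inl rfl))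
  have h2 : Black (grid p q) (comb p q) (⟨2, by omega⟩, ⟨q - 1, by omega⟩) :=
    Black.initial (mem_comb.2 (Or.inr (Or.inr (Or.inl ⟨rfl, by dsimp only; omega⟩))))
  -- the right end of the spine forces the corner, and then row `0` is forced from right to left
  have h0 : ∀ n c (hc : c < q), q ≤ c + 1 + n →
      Black (grid p q) (comb p q) (⟨0, by omega⟩, ⟨c, hc⟩) := by
    intro n
    induction n with
    | zero =>
      intro c hc hn
      refine Black.force (h1 c hc) (grid_adj.2 (by simp)) ?_
      rintro ⟨⟨r', hr'⟩, ⟨c', hc'⟩⟩ hadj hne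
      rw [grid_adj] at hadj
      simp only [Fin.mk.injEq] at hadj
      rcases hadj with ⟨h | h, rfl⟩ | ⟨h, rfl⟩
      · obtain rfl : r' = 2 := by omega
        obtain rfl : c = q - 1 := by omega
        exact h2
      · obtain rfl : r' = 0 := by omega
        exact absurd rfl hne
      · exact h1 c' hc'
    | succ n ih =>
      intro c hc hn
      by_cases hcq : q ≤ c + 1 + n
      · exact ih c hc hcq
      refine Black.force (ih (c + 1) (by omega) (by omega)) (grid_adj.2 (by simp)) ?_
      rintro ⟨⟨r', hr'⟩, ⟨c', hc'⟩⟩ hadj hne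
      rw [grid_adj] at hadj
      simp only [Fin.mk.injEq] at hadj
      rcases hadj with ⟨h | h, rfl⟩ | ⟨h | h, rfl⟩
      · obtain rfl : r' = 1 := by omega
        exact h1 _ hc'
      · omega
      · exact ih c' hc' (by omega)
      · obtain rfl : c' = c := by omega
        exact absurd rfl hne
  have key : ∀ n r (hr : r < p) c (hc : c < q), r ≤ n →
      Black (grid p q) (comb p q) (⟨r, hr⟩, ⟨c, hc⟩) := by
    intro n
    induction n with
    | zero =>
      intro r hr c hc hn
      obtain rfl : r = 0 := by omega
      exact h0 q c hc (by omega)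
    | succ n ih =>
      intro r hr c hc hn
      by_cases hrn : r ≤ n
      · exact ih r hr c hc hrn
      obtain rfl : r = n + 1 := by omega
      rcases Nat.eq_zero_or_pos n with rfl | hn0
      · exact h1 c hc
      refine Black.force (ih n (by omega) c hc le_rfl) (grid_adj.2 (by simp)) ?_
      rintro ⟨⟨r', hr'⟩, ⟨c', hc'⟩⟩ hadj hne
      rw [grid_adj] at hadj
      simp only [Fin.mk.injEq] at hadj
      rcases hadj with ⟨h | h, rfl⟩ | ⟨h, rfl⟩
      · obtain rfl : r' = n + 1 := by omega
        exact absurd rfl hne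
      · exact ih r' hr' _ hc' (by omega)
      · exact ih _ hr' c' hc' le_rfl
  exact fun v => key p v.1.1 v.1.2 v.2.1 v.2.2 v.1.2.le

theorem comb_connectedDomForcing (hp : 4 ≤ p) (hq : 4 ≤ q) (h : q % 3 = 1 → p % 3 = 1) :
    IsConnectedDomForcing (grid p q) (comb p q) :=
  ⟨⟨comb_dominating hp h, comb_connected hp hq⟩, comb_zeroForcing hp hq, comb_connected hp hq⟩

/-- The size of the comb. The cell below the right end of the spine belongs to a tooth if `q` is `2`
modulo `3`, and the pegs are present only if `q` is `1` modulo `3`. -/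
lemma card_comb_le (hp : 4 ≤ p) (hq : 4 ≤ q) : #(comb p q) ≤ q + (p - 2) * ((q + 1) / 3) +
    (if q % 3 = 2 then 0 else 1) + (if q % 3 = 1 then ((p - 3) / 3) * 2 else 0) := by
  let s1 : Finset (ℕ × ℕ) := (Finset.range q).image fun c => (1, c)
  let s2 : Finset (ℕ × ℕ) := (Finset.range (p - 2) ×ˢ Finset.range ((q + 1) / 3)).image
    fun a => (a.1 + 2, 3 * a.2 + 1)
  let s3 : Finset (ℕ × ℕ) := if q % 3 = 2 then ∅ else {(2, q - 1)}
  let s4 : Finset (ℕ × ℕ) := if q % 3 = 1 then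
    (Finset.range ((p - 3) / 3) ×ˢ Finset.range 2).image fun a => (3 * a.1 + 5, q - 2 + a.2) else ∅
  have h1 : #(comb p q) ≤ #(s1 ∪ s2 ∪ s3 ∪ s4) := by
    refine card_le_card_of_injOn (fun v => (v.1.1, v.2.1)) ?_ ?_
    · rintro ⟨⟨r, hr⟩, ⟨c, hc⟩⟩ hv
      have hv := mem_comb.1 hv
      simp only [coe_union, Set.mem_union, mem_coe]
      dsimp only at hv
      by_cases hs2 : 2 ≤ r ∧ c % 3 = 1
      · exact Or.inl (Or.inl (Or.inr (mem_image.2 ⟨(r - 2, c / 3), by simp; omega,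
          by simp; omega⟩)))
      rcases hv with h | h | h | h
      · exact Or.inl (Or.inl (Or.inl (mem_image.2 ⟨c, by simpa using hc, by simp [h]⟩)))
      · exact absurd h hs2
      · have h2 : q % 3 ≠ 2 := by omega
        refine Or.inl (Or.inr ?_)
        simp only [s3, if_neg h2, mem_singleton, Prod.mk.injEq]
        omega
      · refine Or.inr ?_
        simp only [s4, if_pos h.1]
        exact mem_image.2 ⟨((r - 5) / 3, c + 2 - q), by simp; omega, by simp; omega⟩
    · rintro ⟨⟨r, hr⟩, ⟨c, hc⟩⟩ - ⟨⟨r', hr'⟩, ⟨c', hc'⟩⟩ - h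
      simpa using h
  have e1 : #s1 ≤ q := card_image_le.trans (by simp)
  have e2 : #s2 ≤ (p - 2) * ((q + 1) / 3) := card_image_le.trans (by simp)
  have e3 : #s3 ≤ if q % 3 = 2 then 0 else 1 := by
    simp only [s3]
    split_ifs <;> simp
  have e4 : #s4 ≤ if q % 3 = 1 then ((p - 3) / 3) * 2 else 0 := by
    simp only [s4]
    split_ifs
    · exact card_image_le.trans (by simp)
    · simp
  have f1 := card_union_le (s1 ∪ s2 ∪ s3) s4
  have f2 := card_union_le (s1 ∪ s2) s3
  have f3 := card_union_le s1 s2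
  omega

end DomForcing

/-! ### The two numbers of the grid -/

namespace DomForcing

open Finset

variable {p q : ℕ}

/-- The size of the comb in terms of the residue of the number of columns. -/
lemma three_mul_card_comb_le (hp : 4 ≤ p) (hq : 4 ≤ q) :
    (q % 3 = 2 → 3 * #(comb p q) + 2 ≤ p * q + p + q) ∧
    (p % 3 = 1 → q % 3 = 1 → 3 * #(comb p q) + 3 ≤ p * q + p + q) ∧
    (q % 3 = 0 → 3 * #(comb p q) ≤ p * q + q + 3) := by
  have h := card_comb_le hp hq
  obtain ⟨a, rfl⟩ := Nat.exists_eq_add_of_le' hp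
  refine ⟨fun h2 => ?_, fun h1 h2 => ?_, fun h2 => ?_⟩
  · obtain ⟨b, rfl⟩ : ∃ b, q = 3 * b + 2 := ⟨q / 3, by omega⟩
    rw [show (3 * b + 2 + 1) / 3 = b + 1 by omega, if_pos h2, if_neg (by omega),
      show a + 4 - 2 = a + 2 by omega] at h
    nlinarith
  · obtain ⟨b, rfl⟩ : ∃ b, q = 3 * b + 1 := ⟨q / 3, by omega⟩
    obtain ⟨k, rfl⟩ : ∃ k, a = 3 * k := ⟨a / 3, by omega⟩
    rw [show (3 * b + 1 + 1) / 3 = b by omega, if_neg (by omega), if_pos h2,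
      show 3 * k + 4 - 2 = 3 * k + 2 by omega, show (3 * k + 4 - 3) / 3 = k by omega] at h
    nlinarith
  · obtain ⟨b, rfl⟩ : ∃ b, q = 3 * b := ⟨q / 3, by omega⟩
    rw [show (3 * b + 1) / 3 = b by omega, if_neg (by omega), if_neg (by omega),
      show a + 4 - 2 = a + 2 by omega] at h
    nlinarith

lemma connectedDominationNumber_le {V : Type*} {G : SimpleGraph V} {D : Finset V}
    (h : IsConnectedDominating G D) : connectedDominationNumber G ≤ #D :=
  Nat.sInf_le ⟨D, h, rfl⟩

lemma exists_connectedDominationNumber {V : Type*} {G : SimpleGraph V} {D : Finset V}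
    (h : IsConnectedDominating G D) :
    ∃ D, IsConnectedDominating G D ∧ #D = connectedDominationNumber G :=
  Nat.sInf_mem (s := {n : ℕ | ∃ D : Finset V, IsConnectedDominating G D ∧ #D = n}) ⟨_, D, h, rfl⟩

lemma connectedDomForcingNumber_le {V : Type*} {G : SimpleGraph V} {D : Finset V}
    (h : IsConnectedDomForcing G D) : connectedDomForcingNumber G ≤ #D :=
  Nat.sInf_le ⟨D, h, rfl⟩

lemma connectedDominationNumber_le_connectedDomForcingNumber {V : Type*} {G : SimpleGraph V}
    {D : Finset V} (h : IsConnectedDomForcing G D) :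
    connectedDominationNumber G ≤ connectedDomForcingNumber G := by
  obtain ⟨D', h', e⟩ := Nat.sInf_mem
    (s := {n : ℕ | ∃ D : Finset V, IsConnectedDomForcing G D ∧ #D = n}) ⟨_, D, h, rfl⟩
  rw [connectedDomForcingNumber, ← e]
  exact connectedDominationNumber_le h'.1

lemma exists_card_le_comb_swap (hp : 4 ≤ p) (hq : 4 ≤ q) (h : p % 3 = 1 → q % 3 = 1) :
    ∃ D, IsConnectedDomForcing (grid p q) D ∧ #D ≤ #(comb q p) :=
  exists_swap ⟨_, comb_connectedDomForcing hq hp h, le_rfl⟩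

/-- The lower bounds for the connected domination number of the grid, over all residues. -/
lemma le_three_mul_connectedDominationNumber (hp : 4 ≤ p) (hq : 4 ≤ q) {D : Finset (Fin p × Fin q)}
    (hD : IsConnectedDominating (grid p q) D) {g : ℕ}
    (hg : connectedDominationNumber (grid p q) = g) :
    (p % 3 ≠ 0 → q % 3 ≠ 0 → p * q + p + q ≤ 3 * g + 3) ∧
    (p % 3 ≠ 0 → q % 3 = 0 → p * q + q ≤ 3 * g) ∧
    (p % 3 = 0 → q % 3 ≠ 0 → p * q + p ≤ 3 * g) ∧
    (p % 3 = 0 → q % 3 = 0 → p * q + q ≤ 3 * g ∨ p * q + p ≤ 3 * g) := by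
  obtain ⟨S, hS, e⟩ := exists_connectedDominationNumber hD
  rw [hg] at e
  have h := connDom_of_isConnectedDominating hS
  have h1 := h.le_of_not_dvd hp hq
  have h2 := h.le_of_dvd hp hq
  have h3 := fun a b => h.swap.le_of_dvd hq hp b a
  have h4 := h.le_of_dvd_dvd hp hq
  simp only [card_map, e] at h1 h2 h3 h4
  rw [mul_comm q p] at h3
  exact ⟨h1, h2, h3, h4⟩

/-- The lower bounds and the sizes of the two combs, compared over all residues of `p` and `q`. -/
lemma connectedDomForcingNumber_bounds (hp : 4 ≤ p) (hq : 4 ≤ q) {g F : ℕ}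
    (hg : connectedDominationNumber (grid p q) = g)
    (hF : connectedDomForcingNumber (grid p q) = F) :
    g ≤ F ∧ F ≤ g + 1 ∧ (p % 3 = 1 → q % 3 = 1 → F = g ∧ 3 * F + 3 = p * q + p + q) ∧
    (p % 3 ≠ 0 → q % 3 ≠ 0 → p % 3 = 2 ∨ q % 3 = 2 → F = g ∧ 3 * F + 2 = p * q + p + q) := by
  have hu : (q % 3 = 1 → p % 3 = 1) → F ≤ #(comb p q) := fun h =>
    hF ▸ connectedDomForcingNumber_le (comb_connectedDomForcing hp hq h)
  have hu' : (p % 3 = 1 → q % 3 = 1) → F ≤ #(comb q p) := fun h => by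
    obtain ⟨D, hD, hle⟩ := exists_card_le_comb_swap hp hq h
    exact hF ▸ (connectedDomForcingNumber_le hD).trans hle
  obtain ⟨D, hD⟩ : ∃ D, IsConnectedDomForcing (grid p q) D := by
    by_cases h : q % 3 = 1 → p % 3 = 1
    · exact ⟨_, comb_connectedDomForcing hp hq h⟩
    · obtain ⟨D, hD, -⟩ := exists_card_le_comb_swap hp hq (fun h' => by omega)
      exact ⟨D, hD⟩
  have hgF := connectedDominationNumber_le_connectedDomForcingNumber hD
  have hl := le_three_mul_connectedDominationNumber hp hq hD.1 hg
  have hc := three_mul_card_comb_le hp hq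
  have hc' := three_mul_card_comb_le hq hp
  rw [hg, hF] at hgF
  rw [mul_comm q p] at hc'
  have hm := Nat.mul_mod p q 3
  generalize p * q = n at *
  rcases (by omega : p % 3 = 0 ∨ p % 3 = 1 ∨ p % 3 = 2) with h | h | h <;>
    rcases (by omega : q % 3 = 0 ∨ q % 3 = 1 ∨ q % 3 = 2) with h' | h' | h' <;>
    simp [h, h'] at hm hl hc hc' hu hu' ⊢ <;> omega

end DomForcing

theorem mainTheorem2 (p q : ℕ) (hp : 4 ≤ p) (hq : 4 ≤ q) :
    (DomForcing.connectedDominationNumber (DomForcing.grid p q)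
        ≤ DomForcing.connectedDomForcingNumber (DomForcing.grid p q) ∧
      DomForcing.connectedDomForcingNumber (DomForcing.grid p q)
        ≤ DomForcing.connectedDominationNumber (DomForcing.grid p q) + 1) ∧
    (¬ 3 ∣ p → ¬ 3 ∣ q →
      DomForcing.connectedDomForcingNumber (DomForcing.grid p q)
        = DomForcing.connectedDominationNumber (DomForcing.grid p q)) ∧
    (p % 3 = 1 → q % 3 = 1 →
      (DomForcing.connectedDomForcingNumber (DomForcing.grid p q) : ℚ)
        = ((p : ℚ) * (q : ℚ) + (p : ℚ) + (q : ℚ) - 3) / 3) ∧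
    (¬ 3 ∣ p → ¬ 3 ∣ q → (p % 3 = 2 ∨ q % 3 = 2) →
      (DomForcing.connectedDomForcingNumber (DomForcing.grid p q) : ℚ)
        = ((p : ℚ) * (q : ℚ) + (p : ℚ) + (q : ℚ) - 2) / 3) := by
  obtain ⟨h1, h2, h3, h4⟩ := DomForcing.connectedDomForcingNumber_bounds hp hq rfl rfl
  refine ⟨⟨h1, h2⟩, fun a b => ?_, fun a b => ?_, fun a b c => ?_⟩
  · by_cases h : p % 3 = 1 ∧ q % 3 = 1
    · exact (h3 h.1 h.2).1
    · exact (h4 (by omega) (by omega) (by omega)).1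
  · have h : (3 * DomForcing.connectedDomForcingNumber (DomForcing.grid p q) + 3 : ℚ)
        = p * q + p + q := by exact_mod_cast (h3 a b).2
    linarith
  · have h : (3 * DomForcing.connectedDomForcingNumber (DomForcing.grid p q) + 2 : ℚ)
        = p * q + p + q := by exact_mod_cast (h4 (by omega) (by omega) c).2
    linarith
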